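/- All rings are associative with $1$ and modules are right modules. For a ring $A$, a simple $A$-module $S$ and an $A$-module $M$ of finite length, let $m_S(M)$ be the multiplicity of $S$ as a composition factor of $M$. We say that $A$ **satisfies $\mathfrak{X}$** if any two indecomposable $A$-modules $M,N$ of finite length with $m_S(M)=m_S(N)$ for all simple $A$-modules $S$ are isomorphic. **Theorem.** Let $R$ be a commutative artinian ring and let $\Lambda$ be an Artin $R$-algebra, that is, an $R$-algebra that is finitely generated as an $R$-module. Assume that $\Lambda$ is hereditary (every right ideal of $\Lambda$ is projective), indecomposable (nonzero and not a product of two nonzero rings) and basic ($\Lambda=P_1\oplus\dots\oplus P_m$ as a module over itself, with pairwise non-isomorphic indecomposable projective modules $P_k$). Let $J$ be the Jacobson radical of $\Lambda$ and let $\{e_1,\dots,e_n\}$ be a complete set of primitive orthogonal idempotents of $\Lambda$. Put $F_i=e_i\Lambda e_i$ (a division ring) and regard $e_iJe_j$ as an $F_i$-$F_j$-bimodule. If there exist $i\neq j$ such that $$\dim_{F_i}(e_iJe_j)\cdot\dim (e_iJe_j)_{F_j}\ \geq\ 4,$$ then $\Lambda$ does not satisfy $\mathfrak{X}$. -/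

import Mathlib

/-! Right modules over a ring `A` are modules over the opposite ring `Aᵐᵒᵖ`, with
`x * a = MulOpposite.op a • x`. -/

section Modules

variable (A : Type*) [Ring A]

/-- A module is indecomposable if it is nonzero and is not the direct sum of two nonzero
submodules. -/
def IsIndecomposableModule (M : Type*) [AddCommGroup M] [Module A M] : Prop :=
  Nontrivial M ∧ ∀ p q : Submodule A M, IsCompl p q → p = ⊥ ∨ q = ⊥

variable (S M : Type*) [AddCommGroup S] [Module A S] [AddCommGroup M] [Module A M]

/-- The number of factors of a composition series of submodules of `M` that are isomorphic
to `S`. -/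
noncomputable def factorCount (s : CompositionSeries (Submodule A M)) : ℕ :=
  Nat.card {i : Fin s.length //
    Nonempty (S ≃ₗ[A] (s i.succ ⧸ (s i.castSucc).comap (s i.succ).subtype))}

/-- By the Jordan-Hölder theorem the number of factors isomorphic to `S` does not depend on the
composition series. -/
theorem factorCount_eq (s t : CompositionSeries (Submodule A M))
    (hb : s.head = t.head) (ht : s.last = t.last) :
    factorCount A S M s = factorCount A S M t := by
  obtain ⟨f, hf⟩ := s.jordan_holder t hb ht
  refine Nat.card_congr (f.subtypeEquiv fun i => ?_)
  have e := JordanHolderLattice.Iso.linearEquiv (hf i)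
  exact ⟨fun ⟨g⟩ => ⟨g.trans e⟩, fun ⟨g⟩ => ⟨g.trans e.symm⟩⟩

open Classical in
/-- The multiplicity `m_S(M)` of `S` as a composition factor of a module `M` of finite length:
the number of factors isomorphic to `S` in a composition series `0 = M₀ < M₁ < ⋯ < Mₙ = M`.
(The value is `0` by convention when `M` has no composition series.) -/
noncomputable def factorMultiplicity : ℕ :=
  if h : ∃ s : CompositionSeries (Submodule A M), s.head = ⊥ ∧ s.last = ⊤ then
    factorCount A S M h.choose
  else 0

theorem factorMultiplicity_eq (s : CompositionSeries (Submodule A M))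
    (hb : s.head = ⊥) (ht : s.last = ⊤) :
    factorMultiplicity A S M = factorCount A S M s := by
  have h : ∃ s : CompositionSeries (Submodule A M), s.head = ⊥ ∧ s.last = ⊤ := ⟨s, hb, ht⟩
  rw [factorMultiplicity, dif_pos h]
  exact factorCount_eq A S M _ s (h.choose_spec.1.trans hb.symm) (h.choose_spec.2.trans ht.symm)

end Modules

/-- The property `𝔛`: two indecomposable right `A`-modules of finite length in which every simple
right `A`-module has the same multiplicity as a composition factor are isomorphic. (Every module
of finite length and every simple module is isomorphic to one in the universe of `A`.) -/
def SatisfiesX.{u} (A : Type u) [Ring A] : Prop :=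
  ∀ (M N : Type u) [AddCommGroup M] [Module Aᵐᵒᵖ M] [AddCommGroup N] [Module Aᵐᵒᵖ N],
    IsFiniteLength Aᵐᵒᵖ M → IsFiniteLength Aᵐᵒᵖ N →
    IsIndecomposableModule Aᵐᵒᵖ M → IsIndecomposableModule Aᵐᵒᵖ N →
    (∀ (S : Type u) [AddCommGroup S] [Module Aᵐᵒᵖ S], IsSimpleModule Aᵐᵒᵖ S →
      factorMultiplicity Aᵐᵒᵖ S M = factorMultiplicity Aᵐᵒᵖ S N) →
    Nonempty (M ≃ₗ[Aᵐᵒᵖ] N)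

section Rings

variable (A : Type*) [Ring A]

/-- `A` is an Artin algebra over the commutative ring `R`: `R` is artinian and `A` is an
`R`-algebra that is finitely generated as an `R`-module. -/
def IsArtinAlgebra (R : Type*) [CommRing R] [Algebra R A] : Prop :=
  IsArtinianRing R ∧ Module.Finite R A

/-- Right hereditary: every right ideal is projective. -/
def IsRightHereditary : Prop :=
  ∀ I : Submodule Aᵐᵒᵖ A, Module.Projective Aᵐᵒᵖ I

/-- An indecomposable ring: it is nonzero and not a product of two nonzero rings, that is, its
only central idempotents are `0` and `1`. -/
def IsIndecomposableRing : Prop :=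
  Nontrivial A ∧ ∀ c : A, IsIdempotentElem c → (∀ a : A, c * a = a * c) → c = 0 ∨ c = 1

/-- A basic ring: as a right module over itself, it is a finite direct sum of pairwise
non-isomorphic indecomposable projective modules. -/
def IsBasicRing : Prop :=
  ∃ (n : ℕ) (P : Fin n → Submodule Aᵐᵒᵖ A), DirectSum.IsInternal P ∧
    (∀ i, Module.Projective Aᵐᵒᵖ (P i) ∧ IsIndecomposableModule Aᵐᵒᵖ (P i)) ∧
    ∀ i j, i ≠ j → IsEmpty (P i ≃ₗ[Aᵐᵒᵖ] P j)

variable {A}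

/-- A primitive idempotent: a nonzero idempotent that is not the sum of two nonzero orthogonal
idempotents. -/
def IsPrimitiveIdempotent (e : A) : Prop :=
  IsIdempotentElem e ∧ e ≠ 0 ∧
    ∀ f g : A, IsIdempotentElem f → IsIdempotentElem g → f * g = 0 → g * f = 0 → e = f + g →
      f = 0 ∨ g = 0

variable {e f : A}

/-- The additive group `eJf = {e x f | x ∈ J}`, where `J` is the Jacobson radical and `e`, `f`
are idempotents. It is a left module over `eAe` and a right module over `fAf` by the
multiplication of `A`. -/
def JacobsonPeirce (_ : IsIdempotentElem e) (_ : IsIdempotentElem f) : AddSubgroup A where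
  carrier := {y | ∃ x ∈ Ring.jacobson A, y = e * x * f}
  zero_mem' := ⟨0, zero_mem _, by simp⟩
  add_mem' := by
    rintro _ _ ⟨x, hx, rfl⟩ ⟨y, hy, rfl⟩
    exact ⟨x + y, add_mem hx hy, by rw [mul_add, add_mul]⟩
  neg_mem' := by
    rintro _ ⟨x, hx, rfl⟩
    exact ⟨-x, neg_mem hx, by rw [mul_neg, neg_mul]⟩

namespace JacobsonPeirce

variable (he : IsIdempotentElem e) (hf : IsIdempotentElem f)

theorem left_mul_mem (a : he.Corner) (x : JacobsonPeirce he hf) :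
    (a.1 : A) * x.1 ∈ JacobsonPeirce he hf := by
  obtain ⟨x, y, hy, rfl⟩ := x
  have ha := ((Subsemigroup.mem_corner_iff he).mp a.2)
  refine ⟨a.1 * (e * y), Ideal.mul_mem_left _ _ (Ideal.mul_mem_left _ _ hy), ?_⟩
  simp only [← mul_assoc]
  rw [ha.1]

theorem right_mul_mem (x : JacobsonPeirce he hf) (b : hf.Corner) :
    x.1 * (b.1 : A) ∈ JacobsonPeirce he hf := by
  obtain ⟨x, y, hy, rfl⟩ := x
  have hb := ((Subsemigroup.mem_corner_iff hf).mp b.2)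
  refine ⟨y * f * b.1, Ideal.mul_mem_right _ _ (Ideal.mul_mem_right _ _ hy), ?_⟩
  simp only [mul_assoc]
  rw [hb.2]

/-- The left `eAe`-module structure `a • x = a x` of `eJf`. -/
instance leftModule : Module he.Corner (JacobsonPeirce he hf) where
  smul a x := ⟨a.1 * x.1, left_mul_mem he hf a x⟩
  one_smul := by
    rintro ⟨_, y, hy, rfl⟩
    refine Subtype.ext ?_
    change e * (e * y * f) = e * y * f
    simp only [← mul_assoc]
    rw [he.eq]
  mul_smul a b x := Subtype.ext (mul_assoc a.1 b.1 x.1)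
  smul_zero a := Subtype.ext (mul_zero a.1)
  smul_add a x y := Subtype.ext (mul_add a.1 x.1 y.1)
  add_smul a b x := Subtype.ext (add_mul a.1 b.1 x.1)
  zero_smul x := Subtype.ext (zero_mul x.1)

/-- The right `fAf`-module structure `x • b = x b` of `eJf`. -/
instance rightModule : Module (hf.Corner)ᵐᵒᵖ (JacobsonPeirce he hf) where
  smul b x := ⟨x.1 * b.unop.1, right_mul_mem he hf x b.unop⟩
  one_smul := by
    rintro ⟨_, y, hy, rfl⟩
    refine Subtype.ext ?_
    change e * y * f * f = e * y * f
    rw [mul_assoc, hf.eq]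
  mul_smul a b x := Subtype.ext (mul_assoc x.1 b.unop.1 a.unop.1).symm
  smul_zero a := Subtype.ext (zero_mul a.unop.1)
  smul_add a x y := Subtype.ext (add_mul x.1 y.1 a.unop.1)
  add_smul a b x := Subtype.ext (mul_add x.1 a.unop.1 b.unop.1)
  zero_smul x := Subtype.ext (mul_zero x.1)

end JacobsonPeirce

end Rings

/-! Write `e = e_i`, `f = e_j`, `F = eΛe`, `G = fΛf`, `B = eJf`. Since every right ideal is
projective, a nonzero map between indecomposable projectives `fΛ → eΛ` is injective. With the
artinian condition this makes `F` and `G` division rings, and `B ≠ 0` forces `fΛe = 0`.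

Take `P = eΛ` or `P = eΛ × eΛ` and let `N ⊆ P` be generated by elements with entries in `B`. Then
`Ne = 0`, so `Hom(P, N) = 0` and maps between such quotients `P ⧸ N` lift uniquely to `P`.
Indecomposability and isomorphism of the quotients thus become questions about matrices over `F`
acting on `B`, while the composition factors of `P ⧸ N` depend only on the isomorphism class of `N`.
It suffices to find isomorphic `N`, `N'` with indecomposable quotients such that no automorphism of
`P` carries `N'` into `N` (`not_satisfiesX_of_quotients`).

If the product of the dimensions is at least 4, then one dimension is at least 4 or both are at
least 2. The pairs of quotients are `eΛ ⧸ (xΛ + yΛ)` and `eΛ ⧸ (xΛ + bΛ)` if `dim B_G ≥ 4`; `(eΛ)² ⧸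
(x, y)Λ` and `(eΛ)² ⧸ (x, b)Λ` if `dim _F B ≥ 4`; `eΛ ⧸ xΛ` and `eΛ ⧸ bΛ` if both are at least 2. In
each case `b` must avoid the vectors that a nonzero scalar from a subspace `V` moves into a subspace
`W`. Over a field `k` acting centrally these form a family of dimension at most `dim V - 1 + dim W <
dim B`, so a suitable `b` exists (`exists_forall_apply_notMem`). -/

/-! ### Additivity of composition multiplicities -/

section Multiplicity

variable {A S M M' : Type*} [Ring A] [AddCommGroup S] [Module A S]
  [AddCommGroup M] [Module A M] [AddCommGroup M'] [Module A M']

/-- The isomorphism of subquotients induced by a map `g` from `b` onto `b'` under which `a` is the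
preimage of `a'`. -/
noncomputable def subquotientEquivOfSurjective {a b : Submodule A M} {a' b' : Submodule A M'}
    (g : b →ₗ[A] b') (hg : Function.Surjective g) (h : ∀ x : b, (x : M) ∈ a ↔ (g x : M') ∈ a') :
    (b ⧸ a.comap b.subtype) ≃ₗ[A] (b' ⧸ a'.comap b'.subtype) :=
  (Submodule.quotEquivOfEq _ _ (by
      ext x
      simp [h x])).trans
    (((a'.comap b'.subtype).mkQ.comp g).quotKerEquivOfSurjective
      ((Submodule.mkQ_surjective _).comp hg))

theorem subquotient_map_equiv (f : M →ₗ[A] M') (hf : Function.Injective f) (a b : Submodule A M) :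
    Nonempty ((b ⧸ a.comap b.subtype) ≃ₗ[A]
      (b.map f ⧸ (a.map f).comap (b.map f).subtype)) := by
  refine ⟨subquotientEquivOfSurjective
    (f.restrict (p := b) (q := b.map f) fun x hx => Submodule.mem_map_of_mem hx) ?_ ?_⟩
  · rintro ⟨_, x, hx, rfl⟩
    exact ⟨⟨x, hx⟩, rfl⟩
  · intro x
    exact (Function.Injective.mem_set_image hf).symm

theorem subquotient_comap_equiv (f : M →ₗ[A] M') (hf : Function.Surjective f)
    (a b : Submodule A M') :
    Nonempty ((b ⧸ a.comap b.subtype) ≃ₗ[A]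
      (b.comap f ⧸ (a.comap f).comap (b.comap f).subtype)) := by
  refine ⟨(subquotientEquivOfSurjective
    (f.restrict (p := b.comap f) (q := b) fun x hx => hx) ?_ ?_).symm⟩
  · rintro ⟨y, hy⟩
    obtain ⟨x, rfl⟩ := hf y
    exact ⟨⟨x, hy⟩, rfl⟩
  · intro x
    exact Iff.rfl

/-- A map of submodule lattices that induces isomorphisms on subquotients preserves
the covering relation. -/
theorem covBy_of_subquotient_equiv {a b : Submodule A M} {a' b' : Submodule A M'}
    (h : a ⋖ b) (hle : a' ≤ b')
    (e : Nonempty ((b ⧸ a.comap b.subtype) ≃ₗ[A] (b' ⧸ a'.comap b'.subtype))) : a' ⋖ b' := by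
  obtain ⟨e⟩ := e
  have := (covBy_iff_quot_is_simple h.le).1 h
  exact (covBy_iff_quot_is_simple hle).2 (IsSimpleModule.congr e.symm)

/-- The image of a composition series under an order preserving map that induces isomorphisms on
subquotients. -/
def mapOfSubquotientEquiv (s : CompositionSeries (Submodule A M))
    (φ : Submodule A M → Submodule A M') (hφ : Monotone φ)
    (e : ∀ a b : Submodule A M, Nonempty ((b ⧸ a.comap b.subtype) ≃ₗ[A] (φ b ⧸ (φ a).comap (φ b).subtype))) :
    CompositionSeries (Submodule A M') where
  length := s.length
  toFun i := φ (s i)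
  step i := covBy_of_subquotient_equiv (s.step i) (hφ (s.step i).le) (e _ _)

theorem factorCount_mapOfSubquotientEquiv (s : CompositionSeries (Submodule A M))
    (φ : Submodule A M → Submodule A M') (hφ : Monotone φ)
    (e : ∀ a b : Submodule A M, Nonempty ((b ⧸ a.comap b.subtype) ≃ₗ[A] (φ b ⧸ (φ a).comap (φ b).subtype))) :
    factorCount A S M' (mapOfSubquotientEquiv s φ hφ e) = factorCount A S M s := by
  refine Nat.card_congr ((Equiv.refl _).subtypeEquiv fun i => ?_)
  obtain ⟨g⟩ := e (s i.castSucc) (s i.succ)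
  exact ⟨fun ⟨h⟩ => ⟨h.trans g.symm⟩, fun ⟨h⟩ => ⟨h.trans g⟩⟩

open Classical in
theorem factorCount_eq_sum (s : CompositionSeries (Submodule A M)) :
    factorCount A S M s = ∑ i : Fin s.length,
      if Nonempty (S ≃ₗ[A] (s i.succ ⧸ (s i.castSucc).comap (s i.succ).subtype)) then 1 else 0 := by
  rw [factorCount, Nat.card_eq_fintype_card, Fintype.card_subtype, Finset.card_filter]

theorem factorCount_smash (s t : CompositionSeries (Submodule A M)) (h : s.last = t.head) :
    factorCount A S M (s.smash t h) = factorCount A S M s + factorCount A S M t := by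
  classical
  simp only [factorCount_eq_sum]
  refine (Fin.sum_univ_add (a := s.length) (b := t.length) _).trans ?_
  congr 1
  · refine Finset.sum_congr rfl fun i _ => ?_
    have h1 := RelSeries.smash_castAdd h i
    have h2 := RelSeries.smash_succ_castAdd h i
    exact congrArg₂ (fun a b : Submodule A M =>
      if Nonempty (S ≃ₗ[A] (b ⧸ a.comap b.subtype)) then 1 else 0) h1 h2
  · refine Finset.sum_congr rfl fun i _ => ?_
    have h1 := RelSeries.smash_natAdd h i
    have h2 := RelSeries.smash_succ_natAdd h i
    exact congrArg₂ (fun a b : Submodule A M =>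
      if Nonempty (S ≃ₗ[A] (b ⧸ a.comap b.subtype)) then 1 else 0) h1 h2

/-- A series of `N`, pushed forward along the inclusion, and a series of `M ⧸ N`, pulled back along
the projection, meet at `N` and concatenate to a series of `M`. -/
theorem factorMultiplicity_add_quotient [IsNoetherian A M] [IsArtinian A M] (N : Submodule A M) :
    factorMultiplicity A S N + factorMultiplicity A S (M ⧸ N) = factorMultiplicity A S M := by
  obtain ⟨s, hs, hs'⟩ := exists_compositionSeries_of_isNoetherian_isArtinian A N
  obtain ⟨t, ht, ht'⟩ := exists_compositionSeries_of_isNoetherian_isArtinian A (M ⧸ N)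
  let s₁ := mapOfSubquotientEquiv s (Submodule.map N.subtype) (fun _ _ h => Submodule.map_mono h)
    (subquotient_map_equiv N.subtype N.injective_subtype)
  let t₁ := mapOfSubquotientEquiv t (Submodule.comap N.mkQ) (fun _ _ h => Submodule.comap_mono h)
    (subquotient_comap_equiv N.mkQ N.mkQ_surjective)
  have hs₁ : s₁.head = ⊥ := by
    change Submodule.map N.subtype s.head = ⊥
    rw [hs, Submodule.map_bot]
  have hs₂ : s₁.last = N := by
    change Submodule.map N.subtype s.last = N
    rw [hs', Submodule.map_subtype_top]
  have ht₁ : t₁.head = N := by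
    change Submodule.comap N.mkQ t.head = N
    rw [ht]
    exact N.ker_mkQ
  have ht₂ : t₁.last = ⊤ := by
    change Submodule.comap N.mkQ t.last = ⊤
    rw [ht', Submodule.comap_top]
  have h : s₁.last = t₁.head := hs₂.trans ht₁.symm
  rw [factorMultiplicity_eq A S N s hs hs', factorMultiplicity_eq A S (M ⧸ N) t ht ht',
    factorMultiplicity_eq A S M (s₁.smash t₁ h) ((RelSeries.head_smash h).trans hs₁)
      ((RelSeries.last_smash h).trans ht₂), factorCount_smash]
  exact congrArg₂ (· + ·) (factorCount_mapOfSubquotientEquiv s _ _ _).symm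
    (factorCount_mapOfSubquotientEquiv t _ _ _).symm

theorem factorMultiplicity_congr [IsNoetherian A M] [IsArtinian A M] (f : M ≃ₗ[A] M') :
    factorMultiplicity A S M = factorMultiplicity A S M' := by
  obtain ⟨s, hs, hs'⟩ := exists_compositionSeries_of_isNoetherian_isArtinian A M
  let s₁ := mapOfSubquotientEquiv s (Submodule.map (f : M →ₗ[A] M'))
    (fun _ _ h => Submodule.map_mono h) (subquotient_map_equiv (f : M →ₗ[A] M') f.injective)
  rw [factorMultiplicity_eq A S M s hs hs', factorMultiplicity_eq A S M' s₁]
  · exact (factorCount_mapOfSubquotientEquiv s _ _ _).symm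
  · change Submodule.map (f : M →ₗ[A] M') s.head = ⊥
    rw [hs, Submodule.map_bot]
  · change Submodule.map (f : M →ₗ[A] M') s.last = ⊤
    rw [hs', Submodule.map_top, LinearEquiv.range]

theorem factorMultiplicity_quotient_eq [IsNoetherian A M] [IsArtinian A M] {N N' : Submodule A M}
    (f : N ≃ₗ[A] N') :
    factorMultiplicity A S (M ⧸ N) = factorMultiplicity A S (M ⧸ N') := by
  have h := factorMultiplicity_add_quotient (S := S) N
  rw [← factorMultiplicity_add_quotient (S := S) N', factorMultiplicity_congr f] at h
  exact Nat.add_left_cancel h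

end Multiplicity

/-! ### Lifting maps between quotients of a projective module -/

section Quotients

variable {A P : Type*} [Ring A] [AddCommGroup P] [Module A P]

theorem exists_lift_quotient [Module.Projective A P] {N N' : Submodule A P} (f : (P ⧸ N) →ₗ[A] (P ⧸ N')) :
    ∃ α : P →ₗ[A] P, (∀ x, N'.mkQ (α x) = f (N.mkQ x)) ∧ ∀ x ∈ N, α x ∈ N' := by
  obtain ⟨α, hα⟩ := Module.projective_lifting_property N'.mkQ (f.comp N.mkQ) N'.mkQ_surjective
  have h : ∀ x, N'.mkQ (α x) = f (N.mkQ x) := fun x => LinearMap.congr_fun hα x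
  refine ⟨α, h, fun x hx => ?_⟩
  rw [← N'.ker_mkQ, LinearMap.mem_ker, h, N.mkQ_apply, (Submodule.Quotient.mk_eq_zero N).2 hx, map_zero]

/-- Uniqueness of lifts: two lifts of the same map differ by a map `P → N`, which vanishes. -/
theorem eq_of_mkQ_eq {N : Submodule A P} (hN : ∀ h : P →ₗ[A] N, h = 0) {α β : P →ₗ[A] P}
    (h : ∀ x, N.mkQ (α x) = N.mkQ (β x)) : α = β := by
  ext x
  have hx : ∀ x, (α - β) x ∈ N := fun x => (Submodule.Quotient.eq N).1 (h x)
  have := congrArg Subtype.val (LinearMap.congr_fun (hN ((α - β).codRestrict N hx)) x)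
  exact sub_eq_zero.1 this

/-- A quotient `P ⧸ N` with `Hom(P, N) = 0` is indecomposable if `0` and `1` are the only idempotent
endomorphisms of `P` that preserve `N`. -/
theorem isIndecomposableModule_quotient [Module.Projective A P] {N : Submodule A P} (hN : ∀ h : P →ₗ[A] N, h = 0)
    (hP : Nontrivial P)
    (hα : ∀ α : P →ₗ[A] P, (∀ x, α (α x) = α x) → (∀ x ∈ N, α x ∈ N) →
      (∀ x, α x = 0) ∨ ∀ x, α x = x) :
    IsIndecomposableModule A (P ⧸ N) := by
  refine ⟨?_, fun p q hpq => ?_⟩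
  · refine Submodule.Quotient.nontrivial_iff.2 fun h => ?_
    obtain ⟨x, hx⟩ := exists_ne (0 : P)
    refine hx ?_
    subst h
    exact congrArg Subtype.val
      (LinearMap.congr_fun (hN (LinearMap.id.codRestrict ⊤ fun _ => trivial)) x)
  · obtain ⟨α, h, hαN⟩ := exists_lift_quotient (p.projectionOnto q hpq |> p.subtype.comp)
    -- `α` lifts the projection onto `p` along `q`; both `α ∘ α` and `α` lift this idempotent, so
    -- they agree.
    have hα2 : α.comp α = α := eq_of_mkQ_eq hN fun x => by
      rw [LinearMap.comp_apply, h, h, LinearMap.comp_apply, LinearMap.comp_apply,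
        Submodule.subtype_apply, Submodule.subtype_apply, Submodule.projectionOnto_apply_left]
    have key : ∀ y : P ⧸ N, ∃ x, N.mkQ x = y := N.mkQ_surjective
    rcases hα α (fun x => LinearMap.congr_fun hα2 x) hαN with h0 | h1
    · left
      rw [eq_bot_iff]
      intro y hy
      obtain ⟨x, rfl⟩ := key y
      have := h x
      rw [h0, map_zero, LinearMap.comp_apply, Submodule.subtype_apply,
        Submodule.projectionOnto_apply_left hpq ⟨_, hy⟩] at this
      exact this.symm
    · right
      rw [eq_bot_iff]
      intro y hy
      obtain ⟨x, rfl⟩ := key y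
      have := h x
      rw [h1, LinearMap.comp_apply, (Submodule.projectionOnto_apply_eq_zero_iff hpq).2 hy] at this
      exact this

/-- An isomorphism `P ⧸ N ≃ P ⧸ N'` with `Hom(P, N) = 0 = Hom(P, N')` lifts to an automorphism of
`P` that maps `N` into `N'`. -/
theorem exists_lift_quotient_equiv [Module.Projective A P] {N N' : Submodule A P} (hN : ∀ h : P →ₗ[A] N, h = 0)
    (hN' : ∀ h : P →ₗ[A] N', h = 0) (f : (P ⧸ N) ≃ₗ[A] (P ⧸ N')) :
    ∃ α : P ≃ₗ[A] P, ∀ x ∈ N, α x ∈ N' := by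
  obtain ⟨α, h, hα⟩ := exists_lift_quotient (f : (P ⧸ N) →ₗ[A] (P ⧸ N'))
  obtain ⟨β, h', -⟩ := exists_lift_quotient (f.symm : (P ⧸ N') →ₗ[A] (P ⧸ N))
  refine ⟨LinearEquiv.ofLinearMap α β (eq_of_mkQ_eq hN' fun x => ?_) (eq_of_mkQ_eq hN fun x => ?_),
    hα⟩
  · simp only [LinearMap.comp_apply, LinearMap.id_apply, h, h', LinearEquiv.coe_coe,
      LinearEquiv.apply_symm_apply]
  · simp only [LinearMap.comp_apply, LinearMap.id_apply, h, h', LinearEquiv.coe_coe,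
      LinearEquiv.symm_apply_apply]

end Quotients

/-- Two quotients of a projective module that refute property `𝔛`. -/
theorem not_satisfiesX_of_quotients.{u} {Λ : Type u} [Ring Λ] {P : Type u} [AddCommGroup P]
    [Module Λᵐᵒᵖ P] [Module.Projective Λᵐᵒᵖ P] [IsNoetherian Λᵐᵒᵖ P] [IsArtinian Λᵐᵒᵖ P]
    [Nontrivial P] {N N' : Submodule Λᵐᵒᵖ P}
    (hN : ∀ h : P →ₗ[Λᵐᵒᵖ] N, h = 0) (hN' : ∀ h : P →ₗ[Λᵐᵒᵖ] N', h = 0)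
    (hα : ∀ α : P →ₗ[Λᵐᵒᵖ] P, (∀ x, α (α x) = α x) → (∀ x ∈ N, α x ∈ N) →
      (∀ x, α x = 0) ∨ ∀ x, α x = x)
    (hα' : ∀ α : P →ₗ[Λᵐᵒᵖ] P, (∀ x, α (α x) = α x) → (∀ x ∈ N', α x ∈ N') →
      (∀ x, α x = 0) ∨ ∀ x, α x = x)
    (e : Nonempty (N ≃ₗ[Λᵐᵒᵖ] N')) (hne : ∀ α : P ≃ₗ[Λᵐᵒᵖ] P, ¬ ∀ x ∈ N', α x ∈ N) :
    ¬ SatisfiesX Λ := by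
  intro hX
  obtain ⟨e⟩ := e
  obtain ⟨f⟩ := hX (P ⧸ N') (P ⧸ N)
    ((isFiniteLength_iff_isNoetherian_isArtinian ..).2 ⟨inferInstance, inferInstance⟩)
    ((isFiniteLength_iff_isNoetherian_isArtinian ..).2 ⟨inferInstance, inferInstance⟩)
    (isIndecomposableModule_quotient hN' inferInstance hα')
    (isIndecomposableModule_quotient hN inferInstance hα)
    fun S _ _ _ => factorMultiplicity_quotient_eq e.symm
  obtain ⟨α, h⟩ := exists_lift_quotient_equiv hN' hN f
  exact hne α h

/-! ### Dimension counts: avoiding a linear family of subspaces -/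

section Avoidance

open MvPolynomial in
/-- Finitely many polynomial maps into an affine space of larger dimension do not cover it. -/
theorem exists_forall_eval_ne {k σ ι τ : Type*} [Field k] [Infinite k] [Fintype σ] [Fintype ι]
    [Fintype τ] (hcard : Fintype.card σ < Fintype.card ι) (p : τ → ι → MvPolynomial σ k) :
    ∃ b : ι → k, ∀ (t : τ) (x : σ → k), (fun i => eval x (p t i)) ≠ b := by
  have hQ : ∀ t, ∃ Q : MvPolynomial ι k, aeval (p t) Q = 0 ∧ Q ≠ 0 := by
    intro t
    -- There are more coordinates than variables, so the transcendence degree forces a nonzero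
    -- relation `Q t`, which vanishes on the image of `p t`.
    have h : ¬ AlgebraicIndependent k (p t) := fun h => by
      have := h.lift_cardinalMk_le_trdeg
      rw [MvPolynomial.trdeg_of_isDomain] at this
      simp only [Cardinal.mk_fintype, Cardinal.lift_natCast, Nat.cast_le] at this
      omega
    rw [algebraicIndependent_iff] at h
    push Not at h
    exact h
  choose Q hQ0 hQ using hQ
  have hprod : ∏ t, Q t ≠ 0 := Finset.prod_ne_zero_iff.2 fun t _ => hQ t
  obtain ⟨b, hb⟩ : ∃ b, eval b (∏ t, Q t) ≠ 0 := by
    by_contra! h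
    exact hprod (MvPolynomial.funext fun x => by rw [h, map_zero])
  refine ⟨b, fun t x h => hb ?_⟩
  rw [map_prod]
  refine Finset.prod_eq_zero (Finset.mem_univ t) ?_
  have := congrArg (eval x) (hQ0 t)
  rw [map_zero, aeval_def, eval₂_eq', map_sum] at this
  rw [eval_eq', ← h, ← this]
  simp [map_prod]

-- After scaling some coordinate of `u` to `1`, a bad `b` has the form `M⁻¹ W y` with `a + w < m`
-- free parameters. Replacing `M⁻¹` by the adjugate and absorbing the determinant into `y` makes
-- this a polynomial map, one for each choice `t` of the scaled coordinate.
open MvPolynomial in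
theorem exists_mulVec_ne_of_infinite {k : Type*} [Field k] [Infinite k] {a w m : ℕ}
    (h : a + 1 + w ≤ m) (T : Fin (a + 1) → Matrix (Fin m) (Fin m) k)
    (W : Matrix (Fin m) (Fin w) k) :
    ∃ b : Fin m → k, ∀ u : Fin (a + 1) → k, u ≠ 0 → (∑ l, u l • T l).det ≠ 0 →
      ∀ y, (∑ l, u l • T l).mulVec b ≠ W.mulVec y := by
  let U (t : Fin (a + 1)) : Fin (a + 1) → MvPolynomial (Fin a ⊕ Fin w) k :=
    t.insertNth 1 fun s => X (Sum.inl s)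
  let M (t : Fin (a + 1)) : Matrix (Fin m) (Fin m) (MvPolynomial (Fin a ⊕ Fin w) k) :=
    ∑ l, U t l • (T l).map C
  let Y : Fin m → MvPolynomial (Fin a ⊕ Fin w) k :=
    (W.map C).mulVec fun q => X (Sum.inr q)
  obtain ⟨b, hb⟩ := exists_forall_eval_ne (k := k) (σ := Fin a ⊕ Fin w) (ι := Fin m)
    (by simpa using (by omega : a + w < m)) fun t => (M t).adjugate.mulVec Y
  refine ⟨b, fun u hu hdet y hy => ?_⟩
  obtain ⟨t, ht⟩ := Function.ne_iff.1 hu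
  replace ht : u t ≠ 0 := ht
  let N := ∑ l, u l • T l
  -- The second factor of the scalar on `y` cancels the determinant introduced by the adjugate.
  let x : Fin a ⊕ Fin w → k := Sum.elim (fun s => (u t)⁻¹ * u (t.succAbove s))
    (((u t)⁻¹ * ((u t)⁻¹ • N).det⁻¹) • y)
  have hU : ∀ l, eval x (U t l) = (u t)⁻¹ * u l := by
    intro l
    refine Fin.succAboveCases t ?_ (fun s => ?_) l
    · simp [U, ht]
    · simp [U, x]
  have hM : (M t).map (eval x) = (u t)⁻¹ • N := by
    ext i j
    simp only [M, N, Matrix.map_apply, Matrix.sum_apply, Matrix.smul_apply, map_sum, smul_eq_mul,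
      map_mul, hU, eval_C, Finset.mul_sum, mul_assoc]
  have hdet' : ((u t)⁻¹ • N).det ≠ 0 := by
    rw [Matrix.det_smul]
    exact mul_ne_zero (pow_ne_zero _ (inv_ne_zero ht)) hdet
  have hY : (fun i => eval x (Y i)) =
      W.mulVec (((u t)⁻¹ * ((u t)⁻¹ • N).det⁻¹) • y) := by
    ext i
    simp [Y, x, Matrix.mulVec, dotProduct]
  refine hb t x ?_
  have h1 : (fun i => eval x ((M t).adjugate.mulVec Y i)) =
      ((u t)⁻¹ • N).adjugate.mulVec (W.mulVec (((u t)⁻¹ * ((u t)⁻¹ • N).det⁻¹) • y)) := by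
    rw [← hY, ← hM]
    ext i
    rw [RingHom.map_mulVec]
    have := RingHom.map_adjugate (eval x) (M t)
    rw [RingHom.mapMatrix_apply, RingHom.mapMatrix_apply] at this
    rw [this]
    rfl
  rw [h1, Matrix.mulVec_smul, ← hy, mul_comm, mul_smul, ← Matrix.smul_mulVec, Matrix.mulVec_smul,
    Matrix.mulVec_mulVec, Matrix.adjugate_mul, Matrix.smul_mulVec, Matrix.one_mulVec,
    smul_smul, inv_mul_cancel₀ hdet', one_smul]

/-- A linear family `T u`, `u ∈ V`, of endomorphisms of `B` that are injective for `u ≠ 0` and a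
subspace `W` with `dim V + dim W ≤ dim B` have a vector `b` with `T u b ∉ W` for all `u ≠ 0`. -/
theorem exists_forall_apply_notMem {k V B : Type*} [Field k] [AddCommGroup V] [Module k V]
    [AddCommGroup B] [Module k B] [FiniteDimensional k V] [FiniteDimensional k B] [Nontrivial V]
    (T : V →ₗ[k] B →ₗ[k] B) (hT : ∀ u, u ≠ 0 → Function.Injective (T u)) (W : Submodule k B)
    (h : Module.finrank k V + Module.finrank k W ≤ Module.finrank k B) :
    ∃ b, ∀ u, u ≠ 0 → T u b ∉ W := by
  have hV : 0 < Module.finrank k V := Module.finrank_pos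
  rcases finite_or_infinite k with hk | hk
  · have : Finite V := Module.finite_of_finite k
    have : Finite B := Module.finite_of_finite k
    by_contra! hcon
    choose u hu0 hu using hcon
    -- Over a finite field, if each `b` had a bad `u b`, then `b` could be recovered from `u b` and
    -- `T (u b) b`, giving `|B| ≤ (|V| - 1) |W| < |V| |W| ≤ |B|`.
    let f : B → {v : V // v ≠ 0} × W := fun b => (⟨u b, hu0 b⟩, ⟨_, hu b⟩)
    have hf : Function.Injective f := by
      intro b b' hbb
      have h1 : u b = u b' := congrArg (fun z => z.1.1) hbb
      have h2 : T (u b) b = T (u b') b' := congrArg (fun z => z.2.1) hbb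
      rw [← h1] at h2
      exact hT _ (hu0 b) h2
    have h1 := Nat.card_le_card_of_injective f hf
    have h2 : Nat.card {v : V // v ≠ 0} < Nat.card V := by
      have : Nat.card {v : V // v ≠ 0} ≤ Nat.card V :=
        Nat.card_le_card_of_injective _ Subtype.val_injective
      refine lt_of_le_of_ne this fun heq => ?_
      obtain ⟨v, hv⟩ := ((Nat.bijective_iff_injective_and_card _).2
        ⟨Subtype.val_injective, heq⟩).2 0
      exact v.2 hv
    have h3 : 0 < Nat.card W := Nat.card_pos
    rw [Nat.card_prod] at h1
    have h4 := lt_of_le_of_lt h1 (Nat.mul_lt_mul_of_pos_right h2 h3)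
    rw [Module.natCard_eq_pow_finrank (K := k) (V := V),
      Module.natCard_eq_pow_finrank (K := k) (V := W),
      Module.natCard_eq_pow_finrank (K := k) (V := B), ← pow_add] at h4
    exact absurd h4 (not_lt.2 (Nat.pow_le_pow_right Nat.card_pos h))
  · obtain ⟨a, ha⟩ : ∃ a, Module.finrank k V = a + 1 := ⟨Module.finrank k V - 1, by omega⟩
    let v := (Module.finBasisOfFinrankEq k V ha)
    let c := Module.finBasis k B
    let d := Module.finBasis k W
    obtain ⟨b, hb⟩ := exists_mulVec_ne_of_infinite (k := k) (a := a) (w := Module.finrank k W)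
      (m := Module.finrank k B) (by omega) (fun l => LinearMap.toMatrix c c (T (v l)))
      (LinearMap.toMatrix d c W.subtype)
    refine ⟨c.equivFun.symm b, fun u hu hmem => ?_⟩
    have hN : ∑ l, v.repr u l • LinearMap.toMatrix c c (T (v l)) = LinearMap.toMatrix c c (T u) := by
      conv_rhs => rw [← v.sum_repr u]
      simp only [map_sum, map_smul]
    refine hb (v.repr u) (fun h0 => hu ?_) ?_ (d.repr ⟨_, hmem⟩) ?_
    · exact v.repr.map_eq_zero_iff.1 (DFunLike.coe_injective h0)
    · rw [hN]
      have : IsUnit (LinearMap.toMatrix c c (T u)) := by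
        rw [LinearMap.isUnit_toMatrix_iff, Module.End.isUnit_iff]
        exact ⟨hT u hu, LinearMap.injective_iff_surjective.1 (hT u hu)⟩
      exact ((Matrix.isUnit_iff_isUnit_det _).1 this).ne_zero
    · rw [hN, LinearMap.toMatrix_mulVec_repr]
      have hb' : b = c.repr (c.equivFun.symm b) := (c.equivFun.apply_symm_apply b).symm
      conv_lhs => rw [hb']
      rw [LinearMap.toMatrix_mulVec_repr]
      rfl

end Avoidance

/-! ### Avoiding vectors in bimodules over division rings -/

section Bimodule

variable {F H B : Type*} [DivisionRing F] [DivisionRing H] [AddCommGroup B] [Module F B]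
  [Module H B]

/-- The evaluation map `u ↦ u • x`, linear over a field acting through `F`. -/
def smulMap (k : Type*) [Field k] [Module k F] [Module k B] [IsScalarTower k F B] (x : B) :
    F →ₗ[k] B where
  toFun u := u • x
  map_add' u v := add_smul u v x
  map_smul' c u := smul_assoc c u x

theorem finite_of_isScalarTower (k : Type*) [Field k] [Module k F] [Module k B]
    [IsScalarTower k F B] [FiniteDimensional k B] [Nontrivial B] : FiniteDimensional k F := by
  obtain ⟨x, hx⟩ := exists_ne (0 : B)
  exact Module.Finite.of_injective (smulMap k x) (smul_left_injective F hx)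

theorem exists_forall_smul_notMem [SMulCommClass F H B] (k : Type*) [Field k] [Module k F]
    [Module k H] [Module k B] [IsScalarTower k F B] [IsScalarTower k H B] [FiniteDimensional k B]
    [Nontrivial B] (V : Submodule k F) (hV : ∃ u ∈ V, u ≠ 0) (W : Submodule k B)
    (h : Module.finrank k V + Module.finrank k W ≤ Module.finrank k B) :
    ∃ b : B, ∀ u ∈ V, u ≠ 0 → u • b ∉ W := by
  have := finite_of_isScalarTower (F := F) (B := B) k
  -- The action of `k` also factors through `H`, which commutes with `F`; hence `F` acts by
  -- `k`-linear maps.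
  have hcomm : ∀ (u : F) (c : k) (b : B), u • c • b = c • u • b := fun u c b => by
    rw [← one_smul H b, ← smul_assoc c (1 : H) b, smul_comm u, smul_assoc, smul_comm u]
  let T : V →ₗ[k] B →ₗ[k] B := LinearMap.mk₂ k (fun u b => (u : F) • b)
    (fun u v b => add_smul _ _ b) (fun c u b => smul_assoc c (u : F) b)
    (fun u b b' => smul_add _ b b') fun c u b => hcomm u c b
  have : Nontrivial V := by
    obtain ⟨u, hu, hu0⟩ := hV
    exact ⟨⟨u, hu⟩, 0, fun h => hu0 (congrArg Subtype.val h)⟩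
  obtain ⟨b, hb⟩ := exists_forall_apply_notMem T
    (fun u hu => smul_right_injective B fun h => hu (Subtype.ext h)) W h
  exact ⟨b, fun u hu hu0 => hb ⟨u, hu⟩ fun h => hu0 (congrArg Subtype.val h)⟩

/-- A finitely generated bimodule on which an artinian commutative ring acts centrally is a finite
dimensional bimodule over a field. -/
theorem forall_field_of_isArtinianRing.{v} [Nontrivial B] {R : Type v} [CommRing R] [IsArtinianRing R]
    [Module R B] [Module.Finite R B] (ρ : R →+* F) (σ : R →+* H)
    (hρ : ∀ (r : R) (b : B), ρ r • b = r • b) (hσ : ∀ (r : R) (b : B), σ r • b = r • b) {C : Prop}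
    (hC : ∀ (k : Type v) [Field k] [Module k F] [Module k H] [Module k B] [IsScalarTower k F B]
      [IsScalarTower k H B] [FiniteDimensional k B], C) : C := by
  -- Both maps describe the same action on `B ≠ 0`, so `σ` factors through the residue field `R ⧸
  -- ker ρ` as well. The kernel is prime because `F` is a domain, and maximal because `R` is
  -- artinian.
  have hker : ∀ r ∈ RingHom.ker ρ, σ r = 0 := fun r hr => by
    obtain ⟨x, hx⟩ := exists_ne (0 : B)
    have h : σ r • x = 0 := by rw [hσ, ← hρ, (RingHom.mem_ker).1 hr, zero_smul]
    exact (smul_eq_zero.1 h).resolve_right hx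
  have hp : (RingHom.ker ρ).IsPrime := RingHom.ker_isPrime ρ
  have hm : (RingHom.ker ρ).IsMaximal := inferInstance
  let k := R ⧸ RingHom.ker ρ
  let _ : Field k := Ideal.Quotient.field _
  let ρ' : k →+* F := Ideal.Quotient.lift _ ρ fun r hr => hr
  let σ' : k →+* H := Ideal.Quotient.lift _ σ hker
  let _ : Module k F := Module.compHom F ρ'
  let _ : Module k H := Module.compHom H σ'
  let _ : Module k B := Module.compHom B ρ'
  have hB : ∀ (c : k) (b : B), c • b = σ' c • b := fun c b => by
    obtain ⟨r, rfl⟩ := Ideal.Quotient.mk_surjective c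
    exact (hρ r b).trans (hσ r b).symm
  have : IsScalarTower k F B := ⟨fun c u b => mul_smul (ρ' c) u b⟩
  have : IsScalarTower k H B := ⟨fun c u b => (mul_smul (σ' c) u b).trans (hB c _).symm⟩
  have : IsScalarTower R k B := ⟨fun r c b => by
    obtain ⟨s, rfl⟩ := Ideal.Quotient.mk_surjective c
    change ρ (r * s) • b = r • ρ s • b
    rw [map_mul, mul_smul, hρ]⟩
  have : FiniteDimensional k B := Module.Finite.of_restrictScalars_finite R k B
  exact hC k

variable [SMulCommClass F H B] [Nontrivial B] {R : Type*} [CommRing R] [IsArtinianRing R]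
  [Module R B] [Module.Finite R B]

/-- Avoidance with `V = F` and `W = Hx`: the assumptions say that `F` and `H` each have at most half
the `k`-dimension of `B`. -/
theorem exists_forall_smul_ne (ρ : R →+* F) (σ : R →+* H)
    (hρ : ∀ (r : R) (b : B), ρ r • b = r • b) (hσ : ∀ (r : R) (b : B), σ r • b = r • b)
    (hF : 2 ≤ Module.finrank F B) (hH : 2 ≤ Module.finrank H B) (x : B) :
    ∃ b : B, ∀ u : F, u ≠ 0 → ∀ v : H, u • b ≠ v • x := by
  refine forall_field_of_isArtinianRing ρ σ hρ hσ fun k _ _ _ _ _ _ _ => ?_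
  have := finite_of_isScalarTower (F := F) (B := B) k
  have := finite_of_isScalarTower (F := H) (B := B) k
  obtain ⟨b, hb⟩ := exists_forall_smul_notMem (F := F) (H := H) k ⊤ ⟨1, trivial, one_ne_zero⟩
    (LinearMap.range (smulMap (F := H) k x)) (by
      have h1 := Module.finrank_mul_finrank k F B
      have h2 := Module.finrank_mul_finrank k H B
      have h3 := LinearMap.finrank_range_le (smulMap (F := H) k x)
      rw [finrank_top]
      have h4 := Nat.mul_le_mul_left (Module.finrank k F) hF
      have h5 := Nat.mul_le_mul_left (Module.finrank k H) hH
      omega)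
  exact ⟨b, fun u hu v h => hb u trivial hu ⟨v, h.symm⟩⟩

/-- Avoidance with `W = U = Hx + Hy` and `V = {u | u • x ∈ U}`. The map `u ↦ u • x` embeds `V` in
`U`, so `dim V + dim U ≤ 4 dim H ≤ dim B` over `k`. As `1 ∈ V`, the vector `b` lies outside `U`,
which makes `x, b` independent. -/
theorem exists_pairs_forall_smul_ne (ρ : R →+* F) (σ : R →+* H)
    (hρ : ∀ (r : R) (b : B), ρ r • b = r • b) (hσ : ∀ (r : R) (b : B), σ r • b = r • b)
    (hH : 4 ≤ Module.finrank H B) :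
    ∃ x y b : B, (∀ s t : H, s • x + t • y = 0 → s = 0 ∧ t = 0) ∧
      (∀ s t : H, s • x + t • b = 0 → s = 0 ∧ t = 0) ∧
      ∀ u : F, u ≠ 0 → ∀ s t s' t' : H, u • x = s • x + t • y → u • b ≠ s' • x + t' • y := by
  refine forall_field_of_isArtinianRing ρ σ hρ hσ fun k _ _ _ _ _ _ _ => ?_
  have := finite_of_isScalarTower (F := F) (B := B) k
  have := finite_of_isScalarTower (F := H) (B := B) k
  obtain ⟨x, hx⟩ := exists_ne (0 : B)
  have hpair : ∀ z : B, (∀ s : H, s • x ≠ z) → ∀ s t : H, s • x + t • z = 0 → s = 0 ∧ t = 0 := by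
    intro z hz
    rw [← LinearIndependent.pair_iff, LinearIndependent.pair_iff' hx]
    exact hz
  obtain ⟨y, hy⟩ : ∃ y : B, ∀ s : H, s • x ≠ y := by
    by_contra! h
    have := finrank_le_one x h
    omega
  let U : Submodule k B :=
    LinearMap.range ((smulMap (F := H) k x).coprod (smulMap (F := H) k y))
  have hU : Module.finrank k U ≤ 2 * Module.finrank k H := by
    refine (LinearMap.finrank_range_le _).trans ?_
    rw [Module.finrank_prod]
    omega
  have hmem : ∀ s t : H, s • x + t • y ∈ U := fun s t => ⟨(s, t), rfl⟩
  have hxU : x ∈ U := by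
    have := hmem 1 0
    rwa [one_smul, zero_smul, add_zero] at this
  let V : Submodule k F := U.comap (smulMap k x)
  have hV : Module.finrank k V ≤ Module.finrank k U :=
    LinearMap.finrank_le_finrank_of_injective
      (f := (smulMap k x).restrict (p := V) (q := U) fun u hu => hu) fun u v h =>
        Subtype.ext (smul_left_injective F hx (congrArg Subtype.val h))
  obtain ⟨b, hb⟩ := exists_forall_smul_notMem (F := F) (H := H) k V
    ⟨1, by change (1 : F) • x ∈ U; rwa [one_smul], one_ne_zero⟩ U (by
      have h2 := Module.finrank_mul_finrank k H B
      have h5 := Nat.mul_le_mul_left (Module.finrank k H) hH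
      omega)
  refine ⟨x, y, b, hpair y hy, hpair b fun s hs => ?_, fun u hu s t s' t' h h' =>
    hb u ?_ hu (h' ▸ hmem s' t')⟩
  · refine hb 1 ?_ one_ne_zero ?_
    · change (1 : F) • x ∈ U
      rwa [one_smul]
    · rw [one_smul, ← hs]
      have := hmem s 0
      rwa [zero_smul, add_zero] at this
  · change u • x ∈ U
    rw [h]
    exact hmem s t

theorem exists_forall_smul_ne_of_ring {F H : Type*} [Ring F] [Ring H] [Nontrivial F] [Nontrivial H]
    [Module F B] [Module H B] [SMulCommClass F H B] (hF : ∀ a : F, IsUnit a ∨ a = 0)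
    (hH : ∀ a : H, IsUnit a ∨ a = 0) (ρ : R →+* F) (σ : R →+* H)
    (hρ : ∀ (r : R) (b : B), ρ r • b = r • b) (hσ : ∀ (r : R) (b : B), σ r • b = r • b)
    (hF2 : 2 ≤ Module.finrank F B) (hH2 : 2 ≤ Module.finrank H B) (x : B) :
    ∃ b : B, ∀ u : F, u ≠ 0 → ∀ v : H, u • b ≠ v • x := by
  let _ : DivisionRing F := DivisionRing.ofIsUnitOrEqZero hF
  let _ : DivisionRing H := DivisionRing.ofIsUnitOrEqZero hH
  exact exists_forall_smul_ne ρ σ hρ hσ hF2 hH2 x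

theorem exists_pairs_forall_smul_ne_of_ring {F H : Type*} [Ring F] [Ring H] [Nontrivial F]
    [Nontrivial H] [Module F B] [Module H B] [SMulCommClass F H B] (hF : ∀ a : F, IsUnit a ∨ a = 0)
    (hH : ∀ a : H, IsUnit a ∨ a = 0) (ρ : R →+* F) (σ : R →+* H)
    (hρ : ∀ (r : R) (b : B), ρ r • b = r • b) (hσ : ∀ (r : R) (b : B), σ r • b = r • b)
    (hH4 : 4 ≤ Module.finrank H B) :
    ∃ x y b : B, (∀ s t : H, s • x + t • y = 0 → s = 0 ∧ t = 0) ∧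
      (∀ s t : H, s • x + t • b = 0 → s = 0 ∧ t = 0) ∧
      ∀ u : F, u ≠ 0 → ∀ s t s' t' : H, u • x = s • x + t • y → u • b ≠ s' • x + t' • y := by
  let _ : DivisionRing F := DivisionRing.ofIsUnitOrEqZero hF
  let _ : DivisionRing H := DivisionRing.ofIsUnitOrEqZero hH
  exact exists_pairs_forall_smul_ne ρ σ hρ hσ hH4

end Bimodule

/-! ### Indecomposable projectives over a hereditary artinian ring -/

section RightIdeals

open MulOpposite

variable {Λ : Type*} [Ring Λ]

/-- For an idempotent `e`, the right ideal `eΛ`. -/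
def rightIdealOf (e : Λ) : Submodule Λᵐᵒᵖ Λ where
  carrier := {x | e * x = x}
  zero_mem' := mul_zero e
  add_mem' {x y} hx hy := by
    change e * (x + y) = x + y
    rw [mul_add, hx, hy]
  smul_mem' a x hx := by
    change e * (x * a.unop) = x * a.unop
    rw [← mul_assoc, hx]

theorem mul_mem_rightIdealOf {e x : Λ} (hx : e * x = x) (y : Λ) : x * y ∈ rightIdealOf e := by
  change e * (x * y) = x * y
  rw [← mul_assoc, hx]

variable {e f : Λ}

/-- The generator of `eΛ`. -/
def rightIdealOf.gen (he : IsIdempotentElem e) : rightIdealOf e := ⟨e, he⟩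

theorem rightIdealOf.eq_smul_gen (he : IsIdempotentElem e) (x : rightIdealOf e) :
    x = op (x : Λ) • rightIdealOf.gen he :=
  Subtype.ext x.2.symm

theorem rightIdealOf.map_eq (he : IsIdempotentElem e) {M : Type*} [AddCommGroup M] [Module Λᵐᵒᵖ M]
    (h : rightIdealOf e →ₗ[Λᵐᵒᵖ] M) (x : rightIdealOf e) :
    h x = op (x : Λ) • h (rightIdealOf.gen he) := by
  rw [← map_smul, ← rightIdealOf.eq_smul_gen he]

theorem rightIdealOf.map_gen_eq (he : IsIdempotentElem e) {M : Type*} [AddCommGroup M]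
    [Module Λᵐᵒᵖ M] (h : rightIdealOf e →ₗ[Λᵐᵒᵖ] M) :
    h (rightIdealOf.gen he) = op e • h (rightIdealOf.gen he) :=
  rightIdealOf.map_eq he h _

/-- `Hom(eΛ, M)` is `Me`, by evaluation at the generator. -/
theorem rightIdealOf.hom_eq_zero (he : IsIdempotentElem e) {M : Type*} [AddCommGroup M]
    [Module Λᵐᵒᵖ M] (hM : ∀ m : M, op e • m = 0) (h : rightIdealOf e →ₗ[Λᵐᵒᵖ] M) : h = 0 := by
  ext x
  rw [rightIdealOf.map_eq he, rightIdealOf.map_gen_eq he, hM, smul_zero, LinearMap.zero_apply]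

/-- Left multiplication `fΛ → eΛ` by an element `x` with `ex = x`. -/
def rightIdealOf.mulLeft (f : Λ) {x : Λ} (hx : e * x = x) :
    rightIdealOf f →ₗ[Λᵐᵒᵖ] rightIdealOf e where
  toFun z := ⟨x * z, mul_mem_rightIdealOf hx _⟩
  map_add' z w := Subtype.ext (mul_add x z w)
  map_smul' a z := Subtype.ext (mul_assoc x z a.unop).symm

theorem IsPrimitiveIdempotent.eq_zero_or_eq (he : IsPrimitiveIdempotent e) {a : Λ}
    (ha : a * a = a) (hea : e * a = a) (hae : a * e = a) : a = 0 ∨ a = e := by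
  have h1 : (e - a) * (e - a) = e - a := by
    rw [mul_sub, sub_mul, sub_mul, ha, hea, hae, he.1.eq, sub_self, sub_zero]
  have h2 : a * (e - a) = 0 := by rw [mul_sub, ha, hae, sub_self]
  have h3 : (e - a) * a = 0 := by rw [sub_mul, ha, hea, sub_self]
  rcases he.2.2 a (e - a) ha h1 h2 h3 (add_sub_cancel a e).symm with h | h
  · exact Or.inl h
  · exact Or.inr (sub_eq_zero.1 h).symm

/-- The only idempotent endomorphisms of `eΛ`, for `e` primitive, are `0` and `1`. -/
theorem IsPrimitiveIdempotent.end_eq (he : IsPrimitiveIdempotent e)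
    (α : rightIdealOf e →ₗ[Λᵐᵒᵖ] rightIdealOf e) (hα : ∀ x, α (α x) = α x) :
    (∀ x, α x = 0) ∨ ∀ x, α x = x := by
  let a : Λ := α (rightIdealOf.gen he.1)
  have hea : e * a = a := (α (rightIdealOf.gen he.1)).2
  have hae : a * e = a := (congrArg Subtype.val (rightIdealOf.map_gen_eq he.1 α)).symm
  have haa : a * a = a := by
    have := congrArg Subtype.val (hα (rightIdealOf.gen he.1))
    rw [rightIdealOf.map_eq he.1 α (α _)] at this
    exact this
  rcases he.eq_zero_or_eq haa hea hae with h | h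
  · left
    intro x
    rw [rightIdealOf.map_eq he.1, show α (rightIdealOf.gen he.1) = 0 from Subtype.ext h, smul_zero]
  · right
    intro x
    rw [rightIdealOf.map_eq he.1, show α (rightIdealOf.gen he.1) = rightIdealOf.gen he.1 from
      Subtype.ext h, ← rightIdealOf.eq_smul_gen]

/-- The image of `g` is a right ideal, hence projective, so `g` splits onto it. -/
theorem IsRightHereditary.exists_section (hΛ : IsRightHereditary Λ) {M : Type*} [AddCommGroup M]
    [Module Λᵐᵒᵖ M] (g : M →ₗ[Λᵐᵒᵖ] Λ) :
    ∃ s : LinearMap.range g →ₗ[Λᵐᵒᵖ] M, ∀ y, g (s y) = y := by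
  have := hΛ (LinearMap.range g)
  obtain ⟨s, hs⟩ := Module.projective_lifting_property g.rangeRestrict LinearMap.id
    g.surjective_rangeRestrict
  exact ⟨s, fun y => congrArg Subtype.val (LinearMap.congr_fun hs y)⟩

/-- Over a hereditary ring, nonzero maps between indecomposable projectives are injective. -/
theorem IsRightHereditary.eq_zero_of_mul_eq_zero (hΛ : IsRightHereditary Λ)
    (hf : IsPrimitiveIdempotent f) {x z : Λ} (hx : x * f = x) (hx0 : x ≠ 0) (hz : f * z = z)
    (h : x * z = 0) : z = 0 := by
  let g : rightIdealOf f →ₗ[Λᵐᵒᵖ] Λ :=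
    (rightIdealOf 1).subtype.comp (rightIdealOf.mulLeft f (one_mul x))
  obtain ⟨s, hs⟩ := hΛ.exists_section g
  let x' : LinearMap.range g := ⟨x, rightIdealOf.gen hf.1, hx⟩
  let y : Λ := s x'
  have hmul : ∀ a : Λ, y * a = s (op a • x') := fun a => by
    rw [map_smul]; rfl
  have hfy : f * y = y := (s x').2
  have hxy : x * y = x := hs x'
  have hyf : y * f = y := by
    rw [hmul f, show op f • x' = x' from Subtype.ext hx]
  have hyy : y * y = y := by
    rw [hmul y, show op y • x' = x' from Subtype.ext hxy]
  -- The section value `y` at `x` is an idempotent of `fΛf` with `xy = x`. It is not `0`, so it is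
  -- `f`, and then `z = yz` is the section value at `xz = 0`.
  rcases hf.eq_zero_or_eq hyy hfy hyf with h0 | h1
  · rw [h0, mul_zero] at hxy
    exact absurd hxy.symm hx0
  · have := hmul z
    rw [h1, hz, show op z • x' = 0 from Subtype.ext h, map_zero] at this
    exact this

/-- Independence over `fΛf` extends to coefficients in `fΛ`: it forces the section of `(z, w) ↦ xz +
yw` to send `x` to `(f, 0)` and `y` to `(0, f)`, and applying the section to a relation returns its
coefficients. -/
theorem IsRightHereditary.eq_zero_of_add_eq_zero (hΛ : IsRightHereditary Λ)
    (hf : IsIdempotentElem f) {x y : Λ} (hx : x * f = x) (hy : y * f = y)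
    (hxy : ∀ a b : Λ, f * a = a → a * f = a → f * b = b → b * f = b → x * a + y * b = 0 →
      a = 0 ∧ b = 0) {z w : Λ} (hz : f * z = z) (hw : f * w = w) (h : x * z + y * w = 0) :
    z = 0 ∧ w = 0 := by
  let g : rightIdealOf f × rightIdealOf f →ₗ[Λᵐᵒᵖ] Λ := (rightIdealOf 1).subtype.comp
    ((rightIdealOf.mulLeft f (one_mul x)).coprod (rightIdealOf.mulLeft f (one_mul y)))
  obtain ⟨s, hs⟩ := hΛ.exists_section g
  have hg : ∀ z w : rightIdealOf f, g (z, w) = x * z + y * w := fun z w => rfl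
  let x' : LinearMap.range g := ⟨x, (rightIdealOf.gen hf, 0), by
    rw [hg]; exact (congrArg₂ _ hx (mul_zero y)).trans (add_zero x)⟩
  let y' : LinearMap.range g := ⟨y, (0, rightIdealOf.gen hf), by
    rw [hg]; exact (congrArg₂ _ (mul_zero x) hy).trans (zero_add y)⟩
  have hsx : s x' = (rightIdealOf.gen hf, 0) := by
    have h1 : x * (s x').1 + y * (s x').2 = x := hs x'
    have h2 : op f • s x' = s x' := by
      rw [← map_smul, show op f • x' = x' from Subtype.ext hx]
    have h3 : ((s x').1 : Λ) * f = (s x').1 := congrArg (fun p => (p.1 : Λ)) h2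
    have h4 : ((s x').2 : Λ) * f = (s x').2 := congrArg (fun p => (p.2 : Λ)) h2
    have h5 := hxy ((s x').1 - f) (s x').2 (by rw [mul_sub, hf.eq, (s x').1.2])
      (by rw [sub_mul, hf.eq, h3]) (s x').2.2 h4 (by rw [mul_sub, hx, sub_add_eq_add_sub, h1, sub_self])
    exact Prod.ext (Subtype.ext (sub_eq_zero.1 h5.1)) (Subtype.ext h5.2)
  have hsy : s y' = (0, rightIdealOf.gen hf) := by
    have h1 : x * (s y').1 + y * (s y').2 = y := hs y'
    have h2 : op f • s y' = s y' := by
      rw [← map_smul, show op f • y' = y' from Subtype.ext hy]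
    have h3 : ((s y').1 : Λ) * f = (s y').1 := congrArg (fun p => (p.1 : Λ)) h2
    have h4 : ((s y').2 : Λ) * f = (s y').2 := congrArg (fun p => (p.2 : Λ)) h2
    have h5 := hxy (s y').1 ((s y').2 - f) (s y').1.2 h3 (by rw [mul_sub, hf.eq, (s y').2.2])
      (by rw [sub_mul, hf.eq, h4]) (by rw [mul_sub, hy, ← add_sub_assoc, h1, sub_self])
    exact Prod.ext (Subtype.ext h5.1) (Subtype.ext (sub_eq_zero.1 h5.2))
  have h0 : op z • x' + op w • y' = 0 := Subtype.ext h
  have h1 := congrArg s h0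
  rw [map_add, map_smul, map_smul, hsx, hsy, map_zero] at h1
  have h2 : f * z + 0 * w = 0 := congrArg (fun p => (p.1 : Λ)) h1
  have h3 : 0 * z + f * w = 0 := congrArg (fun p => (p.2 : Λ)) h1
  rw [zero_mul, add_zero, hz] at h2
  rw [zero_mul, zero_add, hw] at h3
  exact ⟨h2, h3⟩

/-- Over a right artinian hereditary ring, `eΛe` is a division ring for every primitive
idempotent `e`. -/
theorem IsRightHereditary.exists_mul_eq [IsArtinian Λᵐᵒᵖ Λ] (hΛ : IsRightHereditary Λ)
    (he : IsPrimitiveIdempotent e) {x : Λ} (hex : e * x = x) (hxe : x * e = x) (hx0 : x ≠ 0) :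
    ∃ y, e * y = y ∧ y * e = y ∧ x * y = e ∧ y * x = e := by
  -- Left multiplication by `x` on `eΛ` is injective, hence surjective by the artinian condition;
  -- this gives right inverses.
  have key : ∀ x : Λ, e * x = x → x * e = x → x ≠ 0 →
      ∃ y, e * y = y ∧ y * e = y ∧ x * y = e := by
    intro x hex hxe hx0
    have hinj : Function.Injective (rightIdealOf.mulLeft e hex) := by
      rw [injective_iff_map_eq_zero]
      exact fun z hz => Subtype.ext
        (hΛ.eq_zero_of_mul_eq_zero he hxe hx0 z.2 (congrArg Subtype.val hz))
    obtain ⟨y, hy⟩ := IsArtinian.surjective_of_injective_endomorphism _ hinj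
      (rightIdealOf.gen he.1)
    have hy' : x * y = e := congrArg Subtype.val hy
    refine ⟨y * e, ?_, ?_, ?_⟩
    · rw [← mul_assoc, y.2]
    · rw [mul_assoc, he.1.eq]
    · rw [← mul_assoc, hy', he.1.eq]
  obtain ⟨y, hey, hye, hxy⟩ := key x hex hxe hx0
  have hy0 : y ≠ 0 := by
    rintro rfl
    rw [mul_zero] at hxy
    exact he.2.1 hxy.symm
  obtain ⟨z, hez, hze, hyz⟩ := key y hey hye hy0
  have : x = z := by
    rw [← hxe, ← hyz, ← mul_assoc, hxy, hez]
  exact ⟨y, hey, hye, hxy, by rw [this, hyz]⟩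

theorem eq_zero_of_mem_jacobson (he : IsIdempotentElem e) (hJ : e ∈ Ring.jacobson Λ) : e = 0 := by
  rw [← Ideal.jacobson_bot, Ideal.mem_jacobson_iff] at hJ
  -- The value `-1` yields a left inverse of `1 - e`, which annihilates `e`.
  obtain ⟨z, hz⟩ := hJ (-1)
  have h : z * (1 - e) = 1 := by
    rw [Ideal.mem_bot, sub_eq_zero, mul_neg_one, neg_mul] at hz
    rw [mul_sub, mul_one, ← hz]
    abel
  rw [← one_mul e, ← h, mul_assoc, sub_mul, one_mul, he.eq, sub_self, mul_zero]

/-- If `eJf ≠ 0` then `fΛe = 0`. -/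
theorem IsRightHereditary.eq_zero_of_mem_jacobson [IsArtinian Λᵐᵒᵖ Λ] (hΛ : IsRightHereditary Λ)
    (he : IsPrimitiveIdempotent e) (hf : IsPrimitiveIdempotent f) {x y : Λ}
    (hx : x ∈ Ring.jacobson Λ) (hex : e * x = x) (hxf : x * f = x) (hx0 : x ≠ 0)
    (hfy : f * y = y) (hye : y * e = y) : y = 0 := by
  by_contra hy0
  -- If `y ≠ 0`, then `xy` is a nonzero element of the division ring `eΛe` that lies in `J`, so `e ∈
  -- J`.
  have hxy : x * y ≠ 0 := fun h => hy0 (hΛ.eq_zero_of_mul_eq_zero hf hxf hx0 hfy h)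
  obtain ⟨z, -, -, hz, -⟩ := hΛ.exists_mul_eq he (x := x * y) (by rw [← mul_assoc, hex])
    (by rw [mul_assoc, hye]) hxy
  refine he.2.1 (_root_.eq_zero_of_mem_jacobson he.1 ?_)
  rw [← hz]
  exact Ideal.mul_mem_right _ _ (Ideal.mul_mem_right _ _ hx)

end RightIdeals

/-! ### The three pairs of quotients -/

section Construction

open MulOpposite

theorem smul_eq_zero_of_mem_range {A M P : Type*} [Ring A] [AddCommGroup M] [Module A M]
    [AddCommGroup P] [Module A P] (g : M →ₗ[A] P) {a : A} (h : ∀ m : M, a • m = 0)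
    (y : LinearMap.range g) : a • y = 0 := by
  obtain ⟨_, m, rfl⟩ := y
  exact Subtype.ext (by rw [Submodule.coe_smul, ← map_smul, h, map_zero]; rfl)

variable {Λ : Type*} [Ring Λ] {e f : Λ}

/-- With `fΛe = 0`, images of `fΛ` are annihilated by `e` and so receive no nonzero map from `eΛ`.
-/
theorem rightIdealOf.smul_eq_zero (he : IsIdempotentElem e)
    (hfe : ∀ y, f * y = y → y * e = y → y = 0) (z : rightIdealOf f) : op e • z = 0 := by
  refine Subtype.ext (hfe _ (op e • z).2 ?_)
  change (z : Λ) * e * e = z * e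
  rw [mul_assoc, he.eq]

theorem IsRightHereditary.mulLeft_injective (hΛ : IsRightHereditary Λ)
    (hf : IsPrimitiveIdempotent f) {x : Λ} (hex : e * x = x) (hxf : x * f = x) (hx0 : x ≠ 0) :
    Function.Injective (rightIdealOf.mulLeft f hex) := by
  rw [injective_iff_map_eq_zero]
  exact fun z hz => Subtype.ext
    (hΛ.eq_zero_of_mul_eq_zero hf hxf hx0 z.2 (congrArg Subtype.val hz))

theorem rangeEquiv_of_injective {A M P : Type*} [Ring A] [AddCommGroup M] [Module A M]
    [AddCommGroup P] [Module A P] {g g' : M →ₗ[A] P} (hg : Function.Injective g)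
    (hg' : Function.Injective g') : Nonempty (LinearMap.range g ≃ₗ[A] LinearMap.range g') :=
  ⟨(LinearEquiv.ofInjective g hg).symm.trans (LinearEquiv.ofInjective g' hg')⟩

theorem IsPrimitiveIdempotent.nontrivial_rightIdealOf (he : IsPrimitiveIdempotent e) :
    Nontrivial (rightIdealOf e) :=
  ⟨⟨rightIdealOf.gen he.1, 0, fun h => he.2.1 (congrArg Subtype.val h)⟩⟩

/-- An automorphism of `eΛ` is left multiplication by a nonzero element of `eΛe`. -/
theorem IsPrimitiveIdempotent.exists_corner_mul_eq (he : IsPrimitiveIdempotent e)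
    (α : rightIdealOf e ≃ₗ[Λᵐᵒᵖ] rightIdealOf e) :
    ∃ u : Λ, e * u = u ∧ u * e = u ∧ u ≠ 0 ∧ ∀ x, (α x : Λ) = u * x := by
  refine ⟨α (rightIdealOf.gen he.1), (α _).2, ?_, fun h => ?_, fun x => ?_⟩
  · exact (congrArg Subtype.val (rightIdealOf.map_gen_eq he.1 α.toLinearMap)).symm
  · have : rightIdealOf.gen he.1 = 0 := α.injective ((Subtype.ext h).trans α.map_zero.symm)
    exact he.2.1 (congrArg Subtype.val this)
  · exact congrArg Subtype.val (rightIdealOf.map_eq he.1 α.toLinearMap x)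

/-- Endomorphisms of `eΛ × eΛ` are left multiplications by two-by-two matrices over `eΛe`. -/
theorem rightIdealOf.exists_matrix (he : IsIdempotentElem e)
    (α : rightIdealOf e × rightIdealOf e →ₗ[Λᵐᵒᵖ] rightIdealOf e × rightIdealOf e) :
    ∃ s t s' t' : Λ, (e * s = s ∧ s * e = s) ∧ (e * t = t ∧ t * e = t) ∧
      (e * s' = s' ∧ s' * e = s') ∧ (e * t' = t' ∧ t' * e = t') ∧
      ∀ p, ((α p).1 : Λ) = s * p.1 + t * p.2 ∧ ((α p).2 : Λ) = s' * p.1 + t' * p.2 := by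
  have key : ∀ β : rightIdealOf e →ₗ[Λᵐᵒᵖ] rightIdealOf e,
      ∃ s, (e * s = s ∧ s * e = s) ∧ ∀ x, (β x : Λ) = s * x := fun β =>
    ⟨β (rightIdealOf.gen he), ⟨(β _).2,
      (congrArg Subtype.val (rightIdealOf.map_gen_eq he β)).symm⟩,
      fun x => congrArg Subtype.val (rightIdealOf.map_eq he β x)⟩
  obtain ⟨s, hs, hs'⟩ := key ((LinearMap.fst _ _ _).comp (α.comp (LinearMap.inl _ _ _)))
  obtain ⟨t, ht, ht'⟩ := key ((LinearMap.fst _ _ _).comp (α.comp (LinearMap.inr _ _ _)))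
  obtain ⟨u, hu, hu'⟩ := key ((LinearMap.snd _ _ _).comp (α.comp (LinearMap.inl _ _ _)))
  obtain ⟨v, hv, hv'⟩ := key ((LinearMap.snd _ _ _).comp (α.comp (LinearMap.inr _ _ _)))
  refine ⟨s, t, u, v, hs, ht, hu, hv, fun p => ?_⟩
  have hp : α p = α (p.1, 0) + α (0, p.2) := by
    rw [← map_add, Prod.mk_add_mk, add_zero, zero_add]
  rw [← hs', ← ht', ← hu', ← hv', hp]
  exact ⟨rfl, rfl⟩

/-- The only idempotent endomorphisms of `eΛ × eΛ` that preserve `(x, y)Λ` are `0` and `1` if `x`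
and `y` are left independent over `eΛe`. -/
theorem IsRightHereditary.end_prod_eq (hΛ : IsRightHereditary Λ) (he : IsPrimitiveIdempotent e)
    (hf : IsPrimitiveIdempotent f) {x y : Λ}
    (hex : e * x = x) (hxf : x * f = x) (hey : e * y = y) (hyf : y * f = y) (hx0 : x ≠ 0)
    (hxy : ∀ s t : Λ, e * s = s → s * e = s → e * t = t → t * e = t → s * x + t * y = 0 →
      s = 0 ∧ t = 0)
    (α : rightIdealOf e × rightIdealOf e →ₗ[Λᵐᵒᵖ] rightIdealOf e × rightIdealOf e)
    (hα : ∀ p, α (α p) = α p)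
    (hN : ∀ p ∈ LinearMap.range ((rightIdealOf.mulLeft f hex).prod (rightIdealOf.mulLeft f hey)),
      α p ∈ LinearMap.range ((rightIdealOf.mulLeft f hex).prod (rightIdealOf.mulLeft f hey))) :
    (∀ p, α p = 0) ∨ ∀ p, α p = p := by
  obtain ⟨s, t, s', t', hs, ht, hs', ht', hmat⟩ := rightIdealOf.exists_matrix he.1 α
  obtain ⟨z, hz⟩ := hN (⟨x, hex⟩, ⟨y, hey⟩)
    ⟨rightIdealOf.gen hf.1, Prod.ext (Subtype.ext hxf) (Subtype.ext hyf)⟩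
  -- `α` sends the generator `(x, y)` to `(x, y)z`; cutting by `f` gives `α (x, y) = (x, y)g` with
  -- `g ∈ fΛf`. Idempotence of `α` passes to `g` by cancelling `x`.
  let g : Λ := z * f
  have hfg : f * g = g := by rw [← mul_assoc, z.2]
  have hgf : g * f = g := by rw [mul_assoc, hf.1.eq]
  have h1 : s * x + t * y = x * g := by
    have : x * z = s * x + t * y :=
      (congrArg (fun p => (p.1 : Λ)) hz).trans (hmat (⟨x, hex⟩, ⟨y, hey⟩)).1
    rw [← mul_assoc, this, add_mul, mul_assoc, mul_assoc, hxf, hyf]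
  have h2 : s' * x + t' * y = y * g := by
    have : y * z = s' * x + t' * y :=
      (congrArg (fun p => (p.2 : Λ)) hz).trans (hmat (⟨x, hex⟩, ⟨y, hey⟩)).2
    rw [← mul_assoc, this, add_mul, mul_assoc, mul_assoc, hxf, hyf]
  have hgg : g * g = g := by
    have h3 := congrArg (fun p => (p.1 : Λ)) (hα (⟨x, hex⟩, ⟨y, hey⟩))
    simp only [(hmat _).1, (hmat _).2, h1, h2, ← mul_assoc] at h3
    rw [← add_mul, h1] at h3
    refine sub_eq_zero.1 (hΛ.eq_zero_of_mul_eq_zero hf hxf hx0 ?_ ?_)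
    · rw [mul_sub, ← mul_assoc, hfg]
    · rw [mul_sub, ← mul_assoc, h3, sub_self]
  -- For `g = 0` the rows of `α`, and for `g = f` those of `α - 1`, are relations between `x` and
  -- `y`, hence zero.
  rcases hf.eq_zero_or_eq hgg hfg hgf with h0 | h0
  · rw [h0, mul_zero] at h1 h2
    obtain ⟨rfl, rfl⟩ := hxy s t hs.1 hs.2 ht.1 ht.2 h1
    obtain ⟨rfl, rfl⟩ := hxy s' t' hs'.1 hs'.2 ht'.1 ht'.2 h2
    refine Or.inl fun p => Prod.ext (Subtype.ext ?_) (Subtype.ext ?_)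
    · rw [(hmat p).1, zero_mul, zero_mul, add_zero]; rfl
    · rw [(hmat p).2, zero_mul, zero_mul, add_zero]; rfl
  · rw [h0] at h1 h2
    rw [hxf] at h1
    rw [hyf] at h2
    have h3 := hxy (s - e) t (by rw [mul_sub, hs.1, he.1.eq]) (by rw [sub_mul, hs.2, he.1.eq])
      ht.1 ht.2 (by rw [sub_mul, hex, sub_add_eq_add_sub, h1, sub_self])
    have h4 := hxy s' (t' - e) hs'.1 hs'.2 (by rw [mul_sub, ht'.1, he.1.eq])
      (by rw [sub_mul, ht'.2, he.1.eq]) (by rw [sub_mul, hey, ← add_sub_assoc, h2, sub_self])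
    refine Or.inr fun p => Prod.ext (Subtype.ext ?_) (Subtype.ext ?_)
    · rw [(hmat p).1, sub_eq_zero.1 h3.1, h3.2, zero_mul, add_zero]; exact p.1.2
    · rw [(hmat p).2, sub_eq_zero.1 h4.2, h4.1, zero_mul, zero_add]; exact p.2.2

variable [IsNoetherian Λᵐᵒᵖ Λ] [IsArtinian Λᵐᵒᵖ Λ]

/-- The quotients `eΛ ⧸ xΛ` and `eΛ ⧸ bΛ`. -/
theorem not_satisfiesX_of_elements (hΛ : IsRightHereditary Λ) (he : IsPrimitiveIdempotent e)
    (hf : IsPrimitiveIdempotent f) (hfe : ∀ y, f * y = y → y * e = y → y = 0) {x b : Λ}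
    (hex : e * x = x) (hxf : x * f = x) (hx0 : x ≠ 0) (heb : e * b = b) (hbf : b * f = b)
    (hb0 : b ≠ 0)
    (h : ∀ u v, e * u = u → u * e = u → u ≠ 0 → f * v = v → v * f = v → u * b ≠ x * v) :
    ¬ SatisfiesX Λ := by
  have := he.nontrivial_rightIdealOf
  have : Module.Projective Λᵐᵒᵖ (rightIdealOf e) := hΛ _
  have hz := rightIdealOf.smul_eq_zero he.1 hfe
  refine not_satisfiesX_of_quotients (P := rightIdealOf e)
    (N := LinearMap.range (rightIdealOf.mulLeft f hex))
    (N' := LinearMap.range (rightIdealOf.mulLeft f heb))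
    (rightIdealOf.hom_eq_zero he.1 (smul_eq_zero_of_mem_range _ hz))
    (rightIdealOf.hom_eq_zero he.1 (smul_eq_zero_of_mem_range _ hz))
    (fun α hα _ => he.end_eq α hα) (fun α hα _ => he.end_eq α hα)
    (rangeEquiv_of_injective (hΛ.mulLeft_injective hf hex hxf hx0)
      (hΛ.mulLeft_injective hf heb hbf hb0)) fun α hα => ?_
  obtain ⟨u, heu, hue, hu0, hu⟩ := he.exists_corner_mul_eq α
  obtain ⟨z, hz⟩ := hα ⟨b, heb⟩ ⟨rightIdealOf.gen hf.1, Subtype.ext hbf⟩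
  -- The automorphism would give `ub = xz`; multiplying by `f` on the right moves the coefficient
  -- into `fΛf`.
  refine h u (z * f) heu hue hu0 (by rw [← mul_assoc, z.2]) (by rw [mul_assoc, hf.1.eq]) ?_
  have : x * z = u * b := (congrArg Subtype.val hz).trans (hu _)
  rw [← mul_assoc, this, mul_assoc, hbf]

/-- The quotients `eΛ ⧸ (xΛ + yΛ)` and `eΛ ⧸ (xΛ + bΛ)`. -/
theorem not_satisfiesX_of_right_pairs (hΛ : IsRightHereditary Λ) (he : IsPrimitiveIdempotent e)
    (hf : IsPrimitiveIdempotent f) (hfe : ∀ y, f * y = y → y * e = y → y = 0) {x y b : Λ}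
    (hex : e * x = x) (hxf : x * f = x) (hey : e * y = y) (hyf : y * f = y)
    (heb : e * b = b) (hbf : b * f = b)
    (hxy : ∀ s t : Λ, f * s = s → s * f = s → f * t = t → t * f = t → x * s + y * t = 0 →
      s = 0 ∧ t = 0)
    (hxb : ∀ s t : Λ, f * s = s → s * f = s → f * t = t → t * f = t → x * s + b * t = 0 →
      s = 0 ∧ t = 0)
    (h : ∀ u s t s' t', e * u = u → u * e = u → u ≠ 0 → f * s = s → s * f = s → f * t = t →
      t * f = t → f * s' = s' → s' * f = s' → f * t' = t' → t' * f = t' →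
      u * x = x * s + y * t → u * b ≠ x * s' + y * t') :
    ¬ SatisfiesX Λ := by
  have := he.nontrivial_rightIdealOf
  have : Module.Projective Λᵐᵒᵖ (rightIdealOf e) := hΛ _
  have hz := rightIdealOf.smul_eq_zero he.1 hfe
  have hz2 : ∀ z : rightIdealOf f × rightIdealOf f, op e • z = 0 := fun z =>
    Prod.ext (hz z.1) (hz z.2)
  have hinj : ∀ {w : Λ} (hew : e * w = w), w * f = w →
      (∀ s t : Λ, f * s = s → s * f = s → f * t = t → t * f = t → x * s + w * t = 0 →
        s = 0 ∧ t = 0) →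
      Function.Injective ((rightIdealOf.mulLeft f hex).coprod (rightIdealOf.mulLeft f hew)) := by
    intro w hew hwf hw
    rw [injective_iff_map_eq_zero]
    intro p hp
    have := hΛ.eq_zero_of_add_eq_zero hf.1 hxf hwf hw p.1.2 p.2.2 (congrArg Subtype.val hp)
    exact Prod.ext (Subtype.ext this.1) (Subtype.ext this.2)
  refine not_satisfiesX_of_quotients (P := rightIdealOf e)
    (N := LinearMap.range ((rightIdealOf.mulLeft f hex).coprod (rightIdealOf.mulLeft f hey)))
    (N' := LinearMap.range ((rightIdealOf.mulLeft f hex).coprod (rightIdealOf.mulLeft f heb)))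
    (rightIdealOf.hom_eq_zero he.1 (smul_eq_zero_of_mem_range _ hz2))
    (rightIdealOf.hom_eq_zero he.1 (smul_eq_zero_of_mem_range _ hz2))
    (fun α hα _ => he.end_eq α hα) (fun α hα _ => he.end_eq α hα)
    (rangeEquiv_of_injective (hinj hey hyf hxy) (hinj heb hbf hxb)) fun α hα => ?_
  obtain ⟨u, heu, hue, hu0, hu⟩ := he.exists_corner_mul_eq α
  have key : ∀ w (hew : e * w = w), w * f = w → (⟨w, hew⟩ : rightIdealOf e) ∈
      LinearMap.range ((rightIdealOf.mulLeft f hex).coprod (rightIdealOf.mulLeft f heb)) →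
      ∃ s t, f * s = s ∧ s * f = s ∧ f * t = t ∧ t * f = t ∧ u * w = x * s + y * t := by
    intro w hew hwf hw
    obtain ⟨z, hz⟩ := hα _ hw
    refine ⟨z.1 * f, z.2 * f, by rw [← mul_assoc, z.1.2], by rw [mul_assoc, hf.1.eq],
      by rw [← mul_assoc, z.2.2], by rw [mul_assoc, hf.1.eq], ?_⟩
    have : x * z.1 + y * z.2 = u * w := (congrArg Subtype.val hz).trans (hu _)
    rw [← mul_assoc, ← mul_assoc, ← add_mul, this, mul_assoc, hwf]
  obtain ⟨s, t, hs, hs', ht, ht', hst⟩ := key x hex hxf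
    ⟨(rightIdealOf.gen hf.1, 0), Subtype.ext ((congrArg₂ _ hxf (mul_zero b)).trans (add_zero x))⟩
  obtain ⟨s', t', h1, h2, h3, h4, h5⟩ := key b heb hbf
    ⟨(0, rightIdealOf.gen hf.1), Subtype.ext ((congrArg₂ _ (mul_zero x) hbf).trans (zero_add b))⟩
  exact h u s t s' t' heu hue hu0 hs hs' ht ht' h1 h2 h3 h4 hst h5

/-- The quotients `(eΛ × eΛ) ⧸ (x, y)Λ` and `(eΛ × eΛ) ⧸ (x, b)Λ`. -/
theorem not_satisfiesX_of_left_pairs (hΛ : IsRightHereditary Λ) (he : IsPrimitiveIdempotent e)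
    (hf : IsPrimitiveIdempotent f) (hfe : ∀ y, f * y = y → y * e = y → y = 0) {x y b : Λ}
    (hex : e * x = x) (hxf : x * f = x) (hey : e * y = y) (hyf : y * f = y)
    (heb : e * b = b) (hbf : b * f = b)
    (hxy : ∀ s t : Λ, e * s = s → s * e = s → e * t = t → t * e = t → s * x + t * y = 0 →
      s = 0 ∧ t = 0)
    (hxb : ∀ s t : Λ, e * s = s → s * e = s → e * t = t → t * e = t → s * x + t * b = 0 →
      s = 0 ∧ t = 0)
    (h : ∀ u s t s' t', f * u = u → u * f = u → u ≠ 0 → e * s = s → s * e = s → e * t = t →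
      t * e = t → e * s' = s' → s' * e = s' → e * t' = t' → t' * e = t' →
      x * u = s * x + t * y → b * u ≠ s' * x + t' * y) :
    ¬ SatisfiesX Λ := by
  have hx0 : x ≠ 0 := by
    rintro rfl
    exact he.2.1 (hxy e 0 he.1 he.1 (mul_zero e) (zero_mul e)
      (by rw [mul_zero, zero_mul, add_zero])).1
  have := he.nontrivial_rightIdealOf
  have : Module.Projective Λᵐᵒᵖ (rightIdealOf e) := hΛ _
  have hz := rightIdealOf.smul_eq_zero he.1 hfe
  have hhom : ∀ {w : Λ} (hew : e * w = w) (k : rightIdealOf e × rightIdealOf e →ₗ[Λᵐᵒᵖ]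
      LinearMap.range ((rightIdealOf.mulLeft f hex).prod (rightIdealOf.mulLeft f hew))),
      k = 0 := fun hew k => LinearMap.prod_ext
    ((rightIdealOf.hom_eq_zero he.1 (smul_eq_zero_of_mem_range _ hz) _).trans
      (LinearMap.zero_comp _).symm)
    ((rightIdealOf.hom_eq_zero he.1 (smul_eq_zero_of_mem_range _ hz) _).trans
      (LinearMap.zero_comp _).symm)
  have hinj : ∀ {w : Λ} (hew : e * w = w), Function.Injective
      ((rightIdealOf.mulLeft f hex).prod (rightIdealOf.mulLeft f hew)) := fun hew p q hpq =>
    hΛ.mulLeft_injective hf hex hxf hx0 (congrArg Prod.fst hpq)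
  refine not_satisfiesX_of_quotients (P := rightIdealOf e × rightIdealOf e) (hhom heb) (hhom hey)
    (hΛ.end_prod_eq he hf hex hxf heb hbf hx0 hxb) (hΛ.end_prod_eq he hf hex hxf hey hyf hx0 hxy)
    (rangeEquiv_of_injective (hinj heb) (hinj hey)) fun α hα => ?_
  obtain ⟨s, t, s', t', hs, ht, hs', ht', hmat⟩ := rightIdealOf.exists_matrix he.1 α.toLinearMap
  obtain ⟨z, hz⟩ := hα (⟨x, hex⟩, ⟨y, hey⟩)
    ⟨rightIdealOf.gen hf.1, Prod.ext (Subtype.ext hxf) (Subtype.ext hyf)⟩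
  have h1 : x * z = s * x + t * y :=
    (congrArg (fun p => (p.1 : Λ)) hz).trans (hmat (⟨x, hex⟩, ⟨y, hey⟩)).1
  have h2 : b * z = s' * x + t' * y :=
    (congrArg (fun p => (p.2 : Λ)) hz).trans (hmat (⟨x, hex⟩, ⟨y, hey⟩)).2
  have h3 : x * (z * f) = s * x + t * y := by
    rw [← mul_assoc, h1, add_mul, mul_assoc, mul_assoc, hxf, hyf]
  have h4 : b * (z * f) = s' * x + t' * y := by
    rw [← mul_assoc, h2, add_mul, mul_assoc, mul_assoc, hxf, hyf]
  refine h (z * f) s t s' t' (by rw [← mul_assoc, z.2]) (by rw [mul_assoc, hf.1.eq])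
    (fun h0 => ?_) hs.1 hs.2 ht.1 ht.2 hs'.1 hs'.2 ht'.1 ht'.2 h3 h4
  -- A zero coefficient would mean that the automorphism `α` kills the nonzero vector `(x, y)`.
  rw [h0, mul_zero] at h3 h4
  have h5 : α (⟨x, hex⟩, ⟨y, hey⟩) = 0 :=
    Prod.ext (Subtype.ext ((hmat (⟨x, hex⟩, ⟨y, hey⟩)).1.trans h3.symm))
      (Subtype.ext ((hmat (⟨x, hex⟩, ⟨y, hey⟩)).2.trans h4.symm))
  have h6 := α.map_eq_zero_iff.1 h5
  exact hx0 (congrArg (fun p => (p.1 : Λ)) h6)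

end Construction

/-! ### The bimodule `eJf` and the choice of case -/

section Peirce

open MulOpposite

variable {Λ : Type*} [Ring Λ] {e f : Λ}

instance JacobsonPeirce.smulCommClass (he : IsIdempotentElem e) (hf : IsIdempotentElem f) :
    SMulCommClass he.Corner (hf.Corner)ᵐᵒᵖ (JacobsonPeirce he hf) :=
  ⟨fun a b x => Subtype.ext (mul_assoc a.1 x.1 b.unop.1).symm⟩

theorem JacobsonPeirce.left_mul_eq (he : IsIdempotentElem e) (hf : IsIdempotentElem f)
    (x : JacobsonPeirce he hf) : e * x.1 = x.1 := by
  obtain ⟨_, y, -, rfl⟩ := x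
  rw [← mul_assoc, ← mul_assoc, he.eq]

theorem JacobsonPeirce.right_mul_eq (he : IsIdempotentElem e) (hf : IsIdempotentElem f)
    (x : JacobsonPeirce he hf) : x.1 * f = x.1 := by
  obtain ⟨_, y, -, rfl⟩ := x
  rw [mul_assoc, hf.eq]

theorem JacobsonPeirce.mem_jacobson (he : IsIdempotentElem e) (hf : IsIdempotentElem f)
    (x : JacobsonPeirce he hf) : x.1 ∈ Ring.jacobson Λ := by
  obtain ⟨_, y, hy, rfl⟩ := x
  exact Ideal.mul_mem_right _ _ (Ideal.mul_mem_left _ _ hy)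

/-- The element of the corner ring `eΛe` given by `u` with `eu = u = ue`. -/
def cornerMk (he : IsIdempotentElem e) {u : Λ} (h1 : e * u = u) (h2 : u * e = u) : he.Corner :=
  ⟨u, (Subsemigroup.mem_corner_iff he).2 ⟨h1, h2⟩⟩

theorem corner_mul (he : IsIdempotentElem e) (a : he.Corner) : e * a.1 = a.1 ∧ a.1 * e = a.1 :=
  (Subsemigroup.mem_corner_iff he).1 a.2

theorem IsPrimitiveIdempotent.nontrivial_corner (he : IsPrimitiveIdempotent e) :
    Nontrivial he.1.Corner :=
  ⟨⟨1, 0, fun h => he.2.1 (congrArg Subtype.val h)⟩⟩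

theorem IsRightHereditary.corner_isUnit_or_eq_zero [IsArtinian Λᵐᵒᵖ Λ]
    (hΛ : IsRightHereditary Λ) (he : IsPrimitiveIdempotent e) (a : he.1.Corner) :
    IsUnit a ∨ a = 0 := by
  by_cases h : a = 0
  · exact Or.inr h
  · obtain ⟨y, h1, h2, h3, h4⟩ := hΛ.exists_mul_eq he (corner_mul he.1 a).1 (corner_mul he.1 a).2
      fun h0 => h (Subtype.ext h0)
    exact Or.inl ⟨⟨a, cornerMk he.1 h1 h2, Subtype.ext h3, Subtype.ext h4⟩, rfl⟩

/-- The structure map of the `R`-algebra `eΛe`. -/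
def algebraMapCorner (R : Type*) [CommRing R] [Algebra R Λ] (he : IsIdempotentElem e) :
    R →+* he.Corner where
  toFun r := cornerMk he (u := r • e) (by rw [mul_smul_comm, he.eq]) (by rw [smul_mul_assoc, he.eq])
  map_one' := Subtype.ext (one_smul R e)
  map_zero' := Subtype.ext (zero_smul R e)
  map_add' r s := Subtype.ext (add_smul r s e)
  map_mul' r s := Subtype.ext (by
    change (r * s) • e = r • e * s • e
    rw [smul_mul_smul_comm, he.eq])

theorem not_satisfiesX_of_four_le (R : Type*) [CommRing R] [IsArtinianRing R] [Algebra R Λ]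
    [Module.Finite R Λ] (hΛ : IsRightHereditary Λ) (he : IsPrimitiveIdempotent e)
    (hf : IsPrimitiveIdempotent f)
    (h : 4 ≤ Module.finrank he.1.Corner (JacobsonPeirce he.1 hf.1) *
      Module.finrank (hf.1.Corner)ᵐᵒᵖ (JacobsonPeirce he.1 hf.1)) : ¬ SatisfiesX Λ := by
  have : IsScalarTower R Λᵐᵒᵖ Λ := ⟨fun r a x => mul_smul_comm r x a.unop⟩
  have : IsNoetherian Λᵐᵒᵖ Λ := isNoetherian_of_tower R inferInstance
  have : IsArtinian Λᵐᵒᵖ Λ := isArtinian_of_tower R inferInstance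
  have := he.nontrivial_corner
  have := hf.nontrivial_corner
  let B := JacobsonPeirce he.1 hf.1
  replace h : 4 ≤ Module.finrank he.1.Corner B * Module.finrank (hf.1.Corner)ᵐᵒᵖ B := h
  let ρ := algebraMapCorner R he.1
  let σ : R →+* (hf.1.Corner)ᵐᵒᵖ := (algebraMapCorner R hf.1).toOpposite fun r s => by
    change _ * _ = _ * _
    rw [← map_mul, mul_comm, map_mul]
  -- `R` acts through the left corner; centrality of `R` in `Λ` makes the action through the right
  -- corner the same.
  let _ : Module R B := Module.compHom B ρ
  have hρ : ∀ (r : R) (b : B), ρ r • b = r • b := fun r b => rfl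
  have hval : ∀ (r : R) (b : B), (r • b).1 = r • b.1 := fun r b => by
    change r • e * b.1 = r • b.1
    rw [smul_mul_assoc, JacobsonPeirce.left_mul_eq]
  have hσ : ∀ (r : R) (b : B), σ r • b = r • b := fun r b => Subtype.ext (by
    rw [hval]
    change b.1 * r • f = r • b.1
    rw [mul_smul_comm, JacobsonPeirce.right_mul_eq])
  have : Module.Finite R B := Module.Finite.of_injective
    ({ toFun := Subtype.val, map_add' := fun _ _ => rfl, map_smul' := hval } : B →ₗ[R] Λ)
    Subtype.val_injective
  have : Nontrivial B := by
    by_contra hcon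
    rw [not_nontrivial_iff_subsingleton] at hcon
    rw [Module.finrank_zero_of_subsingleton] at h
    omega
  obtain ⟨x₀, hx₀⟩ := exists_ne (0 : B)
  have hfe : ∀ y, f * y = y → y * e = y → y = 0 := fun y =>
    hΛ.eq_zero_of_mem_jacobson he hf (JacobsonPeirce.mem_jacobson _ _ x₀)
      (JacobsonPeirce.left_mul_eq _ _ x₀) (JacobsonPeirce.right_mul_eq _ _ x₀)
      fun h0 => hx₀ (Subtype.ext h0)
  have hl := JacobsonPeirce.left_mul_eq he.1 hf.1
  have hr := JacobsonPeirce.right_mul_eq he.1 hf.1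
  have hF := hΛ.corner_isUnit_or_eq_zero he
  have hG : ∀ a : (hf.1.Corner)ᵐᵒᵖ, IsUnit a ∨ a = 0 := fun a =>
    (hΛ.corner_isUnit_or_eq_zero hf a.unop).imp (fun h => h.op)
      fun h => MulOpposite.unop_injective h
  by_cases hG4 : 4 ≤ Module.finrank (hf.1.Corner)ᵐᵒᵖ B
  · obtain ⟨x, y, b, hxy, hxb, hne⟩ := exists_pairs_forall_smul_ne_of_ring hF hG ρ σ hρ hσ hG4
    have hpair : ∀ w : B, (∀ s t : (hf.1.Corner)ᵐᵒᵖ, s • x + t • w = 0 → s = 0 ∧ t = 0) →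
        ∀ s t : Λ, f * s = s → s * f = s → f * t = t → t * f = t → x.1 * s + w.1 * t = 0 →
          s = 0 ∧ t = 0 := fun w hw s t h1 h2 h3 h4 h5 => by
      have := hw (op (cornerMk hf.1 h1 h2)) (op (cornerMk hf.1 h3 h4)) (Subtype.ext h5)
      exact ⟨congrArg (fun a => a.unop.1) this.1, congrArg (fun a => a.unop.1) this.2⟩
    exact not_satisfiesX_of_right_pairs hΛ he hf hfe (hl x) (hr x) (hl y) (hr y) (hl b) (hr b)
      (hpair y hxy) (hpair b hxb) fun u s t s' t' hu hu' hu0 hs hs' ht ht' h1 h2 h3 h4 h5 h6 =>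
        hne (cornerMk he.1 hu hu') (fun h0 => hu0 (congrArg Subtype.val h0))
          (op (cornerMk hf.1 hs hs')) (op (cornerMk hf.1 ht ht')) (op (cornerMk hf.1 h1 h2))
          (op (cornerMk hf.1 h3 h4)) (Subtype.ext h5) (Subtype.ext h6)
  by_cases hF4 : 4 ≤ Module.finrank he.1.Corner B
  -- The same choice of vectors with the two sides of the bimodule exchanged.
  · have : SMulCommClass (hf.1.Corner)ᵐᵒᵖ he.1.Corner B := SMulCommClass.symm _ _ _
    obtain ⟨x, y, b, hxy, hxb, hne⟩ := exists_pairs_forall_smul_ne_of_ring hG hF σ ρ hσ hρ hF4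
    have hpair : ∀ w : B, (∀ s t : he.1.Corner, s • x + t • w = 0 → s = 0 ∧ t = 0) →
        ∀ s t : Λ, e * s = s → s * e = s → e * t = t → t * e = t → s * x.1 + t * w.1 = 0 →
          s = 0 ∧ t = 0 := fun w hw s t h1 h2 h3 h4 h5 => by
      have := hw (cornerMk he.1 h1 h2) (cornerMk he.1 h3 h4) (Subtype.ext h5)
      exact ⟨congrArg Subtype.val this.1, congrArg Subtype.val this.2⟩
    exact not_satisfiesX_of_left_pairs hΛ he hf hfe (hl x) (hr x) (hl y) (hr y) (hl b) (hr b)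
      (hpair y hxy) (hpair b hxb) fun u s t s' t' hu hu' hu0 hs hs' ht ht' h1 h2 h3 h4 h5 h6 =>
        hne (op (cornerMk hf.1 hu hu')) (fun h0 => hu0 (congrArg (fun a => a.unop.1) h0))
          (cornerMk he.1 hs hs') (cornerMk he.1 ht ht') (cornerMk he.1 h1 h2)
          (cornerMk he.1 h3 h4) (Subtype.ext h5) (Subtype.ext h6)
  -- Both dimensions are now at most 3, so if one were at most 1 the product would be at most 3.
  obtain ⟨hF2, hG2⟩ : 2 ≤ Module.finrank he.1.Corner B ∧
      2 ≤ Module.finrank (hf.1.Corner)ᵐᵒᵖ B := by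
    constructor <;> by_contra! hcon
    · have := Nat.mul_le_mul_right (Module.finrank (hf.1.Corner)ᵐᵒᵖ B) (Nat.le_of_lt_succ hcon)
      omega
    · have := Nat.mul_le_mul_left (Module.finrank he.1.Corner B) (Nat.le_of_lt_succ hcon)
      omega
  obtain ⟨b, hb⟩ := exists_forall_smul_ne_of_ring hF hG ρ σ hρ hσ hF2 hG2 x₀
  refine not_satisfiesX_of_elements hΛ he hf hfe (hl x₀) (hr x₀)
    (fun h0 => hx₀ (Subtype.ext h0)) (hl b) (hr b) (fun h0 => ?_)
    fun u v hu hu' hu0 hv hv' h5 => hb (cornerMk he.1 hu hu')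
      (fun h0 => hu0 (congrArg Subtype.val h0)) (op (cornerMk hf.1 hv hv')) (Subtype.ext h5)
  -- The scalars `1` and `0` in the avoidance property show `b ≠ 0`.
  refine hb 1 one_ne_zero 0 ?_
  refine Subtype.ext ?_
  change e * b.1 = x₀.1 * 0
  rw [h0, mul_zero, mul_zero]

end Peirce

theorem theorem5p9 (R : Type*) (Λ : Type*) [CommRing R] [Ring Λ] [Algebra R Λ]
    (hArtin : IsArtinAlgebra Λ R) (hHer : IsRightHereditary Λ) (hInd : IsIndecomposableRing Λ)
    (hBasic : IsBasicRing Λ) (n : ℕ) (e : Fin n → Λ) (he : CompleteOrthogonalIdempotents e)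
    (hPrim : ∀ i, IsPrimitiveIdempotent (e i))
    (hDim : ∃ i j : Fin n, i ≠ j ∧
      4 ≤ Module.finrank (he.idem i).Corner (JacobsonPeirce (he.idem i) (he.idem j)) *
        Module.finrank ((he.idem j).Corner)ᵐᵒᵖ (JacobsonPeirce (he.idem i) (he.idem j))) :
    ¬ SatisfiesX Λ := by
  obtain ⟨_, _⟩ := hArtin
  obtain ⟨i, j, -, h⟩ := hDim
  exact not_satisfiesX_of_four_le R hHer (hPrim i) (hPrim j) h
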